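/- Throughout, a 1-manifold is a topological space in which every point has an open neighbourhood homeomorphic to $\mathbb R$; it need not be Hausdorff. Let $T$ be an oriented simply connected 1-manifold. For $x\in T$ the space $T\setminus\{x\}$ has exactly two components; let $x^+$ be the one containing the points just above $x$ in an oriented interval around $x$, and put $x\le y$ iff $y^+\subseteq x^+$. The geodesic spine $GS_{(x,y)}$ is the intersection of all paths from $x$ to $y$; an implicit subtree is a nonempty subset of $T$ containing the geodesic spine of any two of its points; an action on $T$ is minimal if $T$ has no proper invariant implicit subtree. An infinite ray is an increasing union $\bigcup_i GS_{(x,x_i)}$ for a sequence $(x_i)$ that does not converge in $T$; two infinite rays are equivalent if their intersection contains an infinite ray, and an end is an equivalence class of infinite rays. In a poset, write $x\sim_u y$ (resp. $x\sim_l y$) if $x,y$ are incomparable and have a common upper (resp. lower) bound. The order is simply connected if any incomparable $x,y$ satisfy $x\sim_u y$ or $x\sim_l y$, and $x\sim_u y$, $x\sim_l z$ imply $z>y$. It is trivial if there is an incomparable pair and either all incomparable pairs satisfy $\sim_u$ or all satisfy $\sim_l$; otherwise it is nontrivial. An element $b$ is between $a$ and $c$ (a condition on the unordered pair $\{a,c\}$)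 if: $a<c$ and either $a<b<c$ or ($a\sim_u b$ and $b\sim_l c$); or $a\sim_l c$ and either ($a\sim_l b$ and $b<c$) or ($c\sim_l b$ and $b<a$); or $a\sim_u c$ and either ($a\sim_u b$ and $b>c$) or ($c\sim_u b$ and $b>a$). Let $B_{a,b}$ consist of $a$, $b$ and all elements between them. The order is rectifiable if for all $a,b$ the set $B_{a,b}$ is a finite union of classes of the relation on $B_{a,b}$ under which $x,y$ are related iff $B_{x,y}$ is totally ordered. Theorem. Let a countable group $G$ act minimally by orientation-preserving homeomorphisms on an oriented simply connected 1-manifold $T$, such that the number of ends of $T$ fixed by all of $G$ is not exactly one. Let $x\in T$ be a point with trivial stabilizer. Then $$g\le h \iff gx\le hx \text{ in } T$$ defines a left-invariant partial order on $G$, and this order is simply connected, rectifiable and nontrivial. In particular, if some point of $T$ has trivial stabilizer, then $G$ admits a nontrivial left-invariant rectifiable simply connected partial order. -/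

import Mathlib

open Set Filter Topology

/-! ### Posets -/

section Posets

variable {S : Type*} [PartialOrder S]

/-- `x ∼_u y`: the elements are incomparable and have a common upper bound. -/
def SimU (x y : S) : Prop := IncompRel (· ≤ ·) x y ∧ ∃ z, x ≤ z ∧ y ≤ z

/-- `x ∼_l y`: the elements are incomparable and have a common lower bound. -/
def SimL (x y : S) : Prop := IncompRel (· ≤ ·) x y ∧ ∃ z, z ≤ x ∧ z ≤ y

variable (S) in
/-- Any two incomparable elements have a common upper bound or a common lower bound. -/
def StronglyConnectedOrder : Prop := ∀ x y : S, IncompRel (· ≤ ·) x y → SimU x y ∨ SimL x y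

variable (S) in
/-- `x ∼_u y` and `x ∼_l z` imply `y < z`. -/
def AcyclicOrder : Prop := ∀ x y z : S, SimU x y → SimL x z → y < z

variable (S) in
/-- A simply connected partial order: strongly connected and acyclic. -/
def SimplyConnectedOrder : Prop := StronglyConnectedOrder S ∧ AcyclicOrder S

variable (S) in
/-- There is an incomparable pair, and all incomparable pairs are of one and the same type
(`∼_u` or `∼_l`). In particular a total order is not trivial. -/
def TrivialOrder : Prop :=
  (∃ x y : S, IncompRel (· ≤ ·) x y) ∧
    ((∀ x y : S, IncompRel (· ≤ ·) x y → SimU x y) ∨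
      (∀ x y : S, IncompRel (· ≤ ·) x y → SimL x y))

/-- `b` is between `a` and `c`. The first two clauses are the same condition for the two possible
orders of a comparable pair, so that the notion is symmetric in `a` and `c`. -/
def OrderBetween (a b c : S) : Prop :=
  (a < c ∧ ((a < b ∧ b < c) ∨ (SimU a b ∧ SimL b c))) ∨
  (c < a ∧ ((c < b ∧ b < a) ∨ (SimU c b ∧ SimL b a))) ∨
  (SimL a c ∧ ((SimL a b ∧ b < c) ∨ (SimL c b ∧ b < a))) ∨
  (SimU a c ∧ ((SimU a b ∧ c < b) ∨ (SimU c b ∧ a < b)))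

/-- The set `B_{a,b}` consisting of `a`, `b` and all elements between them. -/
def betweenSet (a b : S) : Set S := {a, b} ∪ {x | OrderBetween a x b}

/-- The class of `x` in `B_{a,b}` under the relation
"`B_{x,y}` is totally ordered by the order of `S`". -/
def switchClass (a b x : S) : Set S := {y ∈ betweenSet a b | IsChain (· ≤ ·) (betweenSet x y)}

variable (S) in
/-- Every `B_{a,b}` is a union of finitely many classes of the relation
"`B_{x,y}` is totally ordered". -/
def RectifiableOrder : Prop := ∀ a b : S, (switchClass a b '' betweenSet a b).Finite

end Posets

/-! ### Oriented 1-manifolds, not assumed to be Hausdorff -/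

/-- The real function `f` is strictly increasing near the point `t`. -/
def StrictlyIncreasingNear (f : ℝ → ℝ) (t : ℝ) : Prop := ∃ U ∈ 𝓝 t, StrictMonoOn f U

/-- The structure of an oriented (topological, possibly non-Hausdorff) 1-manifold without boundary
on `T`: an atlas of charts to open subsets of `ℝ` whose transition maps are locally strictly
increasing. -/
structure OrientedOneManifold (T : Type*) [TopologicalSpace T] where
  charts : Set (OpenPartialHomeomorph T ℝ)
  covers : ∀ x : T, ∃ e ∈ charts, x ∈ e.source
  compatible : ∀ e ∈ charts, ∀ e' ∈ charts, ∀ x ∈ e.source ∩ e'.source,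
    StrictlyIncreasingNear (fun s => e' (e.symm s)) (e x)

namespace OrientedOneManifold

variable {T : Type*} [TopologicalSpace T] (A : OrientedOneManifold T)

/-- The self-map `f` preserves the orientation: in the charts it is locally strictly increasing. -/
def PreservesOrientation (f : T → T) : Prop :=
  ∀ e ∈ A.charts, ∀ e' ∈ A.charts, ∀ x ∈ e.source, f x ∈ e'.source →
    StrictlyIncreasingNear (fun s => e' (f (e.symm s))) (e x)

/-- The side `x⁺`: the component of `T ∖ {x}` that contains the points just above `x`
in an oriented interval around `x`. -/
def posSide (x : T) : Set T :=
  {y | ∃ e ∈ A.charts, ∃ t : ℝ, x ∈ e.source ∧ e x < t ∧ Icc (e x) t ⊆ e.target ∧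
    y ∈ connectedComponentIn {x}ᶜ (e.symm t)}

/-- The natural order on the points of an oriented simply connected 1-manifold:
`x ≤ y` if and only if `y⁺ ⊆ x⁺`. -/
def pointLE (x y : T) : Prop := A.posSide y ⊆ A.posSide x

end OrientedOneManifold

/-! ### Geodesic spines, subtrees and ends -/

section Spines

variable {T : Type*} [TopologicalSpace T]

/-- The geodesic spine from `x` to `y`: the intersection of all paths from `x` to `y`. -/
def geodesicSpine (x y : T) : Set T := ⋂ γ : Path x y, range γ

/-- A (nonempty) implicit subtree: a set that contains the geodesic spine of any two of its
points. -/
def IsImplicitSubtree (s : Set T) : Prop :=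
  s.Nonempty ∧ ∀ x ∈ s, ∀ y ∈ s, geodesicSpine x y ⊆ s

/-- `ρ` is an infinite ray: an increasing union of geodesic spines from `x` to `u 0, u 1, …`,
where the sequence `u` does not converge to any point of `T`. -/
def IsInfiniteRay (ρ : Set T) : Prop :=
  ∃ (x : T) (u : ℕ → T), (∀ i j, i < j → geodesicSpine x (u i) ⊆ geodesicSpine x (u j)) ∧
    ρ = ⋃ i, geodesicSpine x (u i) ∧ ¬ ∃ a, Tendsto u atTop (𝓝 a)

/-- Two infinite rays are equivalent if their intersection contains an infinite ray. -/
def RayEquiv (ρ₁ ρ₂ : Set T) : Prop := ∃ ρ, IsInfiniteRay ρ ∧ ρ ⊆ ρ₁ ∩ ρ₂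

/-- An end: an equivalence class of infinite rays. -/
def IsEnd (ε : Set (Set T)) : Prop :=
  ∃ ρ, IsInfiniteRay ρ ∧ ε = {ρ' | IsInfiniteRay ρ' ∧ RayEquiv ρ ρ'}

variable (G : Type*) [Group G] [MulAction G T]

variable (T) in
/-- The action has no proper invariant implicit subtree. -/
def IsMinimalTreeAction : Prop :=
  ∀ s : Set T, IsImplicitSubtree s → (∀ g : G, ∀ x ∈ s, g • x ∈ s) → s = univ

/-- The end `ε` is fixed by every element of the group. -/
def FixesEnd (ε : Set (Set T)) : Prop :=
  ∀ g : G, (fun ρ : Set T => (fun x : T => g • x) '' ρ) '' ε = ε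

end Spines

/-!
A point `x` of an oriented simply connected 1-manifold `T` separates it into two open connected
sides. Otherwise the double cover of `T` obtained by cutting at `x` and regluing crosswise would be
connected, whereas over a simply connected base it has a section
(`not_mem_preconnected_of_locally_separated`, `OrientedOneManifold.sideSystem`). Everything else is
deduced from this separation, formulated as a `SideSystem`. A point lies on the geodesic spine of
`a` and `b` iff it is `a`, `b` or separates them, so spines behave like the intervals of a pretree.
Two distinct points are comparable iff each lies on a side of the other and the two sides have
opposite signs; incomparable pairs come in two kinds, with equal signs `+` or `-`.

By minimality every orbit meets every side of every point, since the union of the spines between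
orbit points is an invariant subtree. This gives a dichotomy for the orbit of `x`.

* If the orbit contains incomparable pairs of both kinds, every half-space contains the upper side
  of some orbit point and the lower side of another one. A path joining a pair with signs `+` turns
  round at some place, just beyond which there is a common upper bound in `T`
  (`SideSystem.exists_common_bound`), hence also one in the orbit
  (`SideSystem.exists_smul_common_bound`). So the kinds of pairs are `∼_u` and `∼_l`, and both occur.
* If all incomparable pairs have sign `+`, say, and there is one, then overlapping lower sides of
  orbit points are nested, and they cover `T`. As `T` is connected and `G` is countable, `T` is an
  increasing union of lower sides of orbit points `k 0 • x < k 1 • x < …`. The ray through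
  these points defines a fixed end. A fixed end lies on the same side of all orbit points; that side
  cannot be the lower one, since an incomparable pair has disjoint lower sides, so it is the
  upper one and the end is the one just found. Thus exactly one end is fixed
  (`SideSystem.existsUnique_fixed_end`), which is excluded.

If there are no incomparable pairs the order is total. Finally, `B_{a,b}` consists of the elements
whose orbit points lie on the spine from `a • x` to `b • x`. A path between these points is covered
by finitely many oriented intervals, and the points of the spine in one such interval belong to
one class (`SideSystem.rectifiableOrder`).
-/

/-! ### The double cover obtained by cutting -/

/-- Let `U`, `V` be an open cover of a simply connected space whose overlap lies in the union of two
disjoint open sets `M`, `K`. The double cover that is trivial over `U` and over `V`, with the sheets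
glued straight over `M` and crosswise over `K`, has a section; `f` and `g` are its sheet numbers over
`U` and `V`. -/
theorem exists_double_cover_section {T : Type*} [TopologicalSpace T] [SimplyConnectedSpace T]
    [LocallyPathConnectedSpace T] {U V M K : Set T} (hU : IsOpen U) (hV : IsOpen V)
    (hUV : U ∪ V = univ) (hM : IsOpen M) (hK : IsOpen K) (hMK : Disjoint M K)
    (hint : U ∩ V ⊆ M ∪ K) :
    ∃ f g : T → Bool, ContinuousOn f U ∧ ContinuousOn g V ∧
      (∀ y ∈ U ∩ V, y ∈ M → f y = g y) ∧ (∀ y ∈ U ∩ V, y ∈ K → f y = !(g y)) := by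
  classical
  let Z : FiberBundleCore Bool T Bool :=
    { baseSet := fun i => if i then U else V
      isOpen_baseSet := by intro i; cases i <;> simpa
      indexAt := fun x => decide (x ∈ U)
      mem_baseSet_at := by
        intro x
        have : x ∈ U ∪ V := hUV ▸ mem_univ x
        by_cases hx : x ∈ U
        · simp [hx]
        · simpa [hx] using this
      coordChange := fun i j y v => if i = j then v else if y ∈ K then !v else v
      coordChange_self := by simp
      continuousOn_coordChange := by
        intro i j
        by_cases hij : i = j
        · simpa [hij] using continuousOn_snd
        · have hsub : (if i then U else V) ∩ (if j then U else V) ⊆ M ∪ K := by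
            intro y hy
            apply hint
            cases i <;> cases j <;> simp_all
          intro p hp
          apply ContinuousAt.continuousWithinAt
          rcases hsub hp.1 with h | h
          · have h0 : ∀ᶠ q : T × Bool in 𝓝 p, q.1 ∈ M :=
              continuous_fst.continuousAt.eventually (hM.mem_nhds h)
            refine (continuous_snd.continuousAt).congr ?_
            filter_upwards [h0] with q hq
            have : q.1 ∉ K := fun h' => hMK.le_bot ⟨hq, h'⟩
            simp [hij, this]
          · have h0 : ∀ᶠ q : T × Bool in 𝓝 p, q.1 ∈ K :=
              continuous_fst.continuousAt.eventually (hK.mem_nhds h)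
            refine ((continuous_of_discreteTopology (f := Bool.not)).comp
              continuous_snd).continuousAt.congr ?_
            filter_upwards [h0] with q hq
            simp [hij, hq]
      coordChange_comp := by
        intro i j k y _ v
        by_cases hy : y ∈ K <;> cases i <;> cases j <;> cases k <;> simp [hy] }
  have hcov : IsCoveringMap (Bundle.TotalSpace.proj : Z.TotalSpace → T) :=
    FiberBundle.isCoveringMap (F := Bool) (E := Z.Fiber)
  have a₀ : T := Classical.arbitrary T
  obtain ⟨σ, ⟨_, hσ⟩, _⟩ := hcov.existsUnique_continuousMap_lifts (ContinuousMap.id T) a₀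
    (⟨a₀, true⟩ : Z.TotalSpace) rfl
  have hσ' : ∀ y, (σ y).1 = y := fun y => congrFun hσ y
  have hcont : ∀ i, ContinuousOn (fun y => ((Z.localTriv i) (σ y)).2) (Z.baseSet i) := by
    intro i
    refine continuous_snd.comp_continuousOn
      ((Z.localTriv i).continuousOn_toFun.comp σ.continuous.continuousOn ?_)
    intro y hy
    rw [Bundle.Trivialization.mem_source]
    exact (congrArg (· ∈ Z.baseSet i) (hσ' y)).mpr hy
  have hch : ∀ i y, ((Z.localTriv i) (σ y)).2 = Z.coordChange (Z.indexAt y) i y (σ y).2 := by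
    intro i y
    rw [Z.localTriv_apply, hσ' y]
  refine ⟨fun y => ((Z.localTriv true) (σ y)).2, fun y => ((Z.localTriv false) (σ y)).2,
    by simpa [Z] using hcont true, by simpa [Z] using hcont false, ?_, ?_⟩
  · intro y hy hyM
    have hyK : y ∉ K := fun h' => hMK.le_bot ⟨hyM, h'⟩
    simp only [hch]
    simp [Z, hyK, hy.1]
    rfl
  · intro y hy hyK
    simp only [hch]
    simp [Z, hyK, hy.1]
    exact (Bool.not_not _).symm

/-- If the removal of `x` splits a connected open neighbourhood `V` of `x` into the parts in `M`
and in `K`, then no connected set that avoids `x` meets both parts: a point that locally separates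
a simply connected space separates it. -/
theorem not_mem_preconnected_of_locally_separated {T : Type*} [TopologicalSpace T]
    [SimplyConnectedSpace T] [LocallyPathConnectedSpace T] {x : T} {V M K C : Set T}
    (hx : IsClosed ({x} : Set T)) (hV : IsOpen V) (hVc : IsPreconnected V) (hxV : x ∈ V)
    (hM : IsOpen M) (hK : IsOpen K) (hMK : Disjoint M K) (hVMK : V \ {x} ⊆ M ∪ K)
    (hC : IsPreconnected C) (hxC : x ∉ C) {a b : T} (ha : a ∈ M) (haV : a ∈ V) (haC : a ∈ C)
    (hb : b ∈ K) (hbV : b ∈ V) : b ∉ C := by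
  intro hbC
  have hU : IsOpen ({x}ᶜ : Set T) := hx.isOpen_compl
  obtain ⟨f, g, hf, hg, h1, h2⟩ := exists_double_cover_section (U := {x}ᶜ) (V := V) hU hV
    (by
      ext y
      by_cases hy : y = x
      · simp [hy, hxV]
      · simp [hy]) hM hK hMK
    (fun y hy => hVMK ⟨hy.2, hy.1⟩)
  have hCU : C ⊆ {x}ᶜ := fun y hy h => hxC (h ▸ hy)
  have e1 : f a = f b := hC.constant (hf.mono hCU) haC hbC
  have e2 : g a = g b := hVc.constant hg haV hbV
  have e3 := h1 a ⟨hCU haC, haV⟩ ha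
  have e4 := h2 b ⟨hCU hbC, hbV⟩ hb
  rw [← e1, ← e2, e3] at e4
  simp at e4

/-! ### Systems of sides -/

/-- A coherent choice of the two sides of every point of a space in which points separate:
`S true x` and `S false x` are the upper and the lower side of `x`. The last field says that each
point has arbitrarily small connected neighbourhoods ("oriented intervals") in which any two
points `a ≠ b` are comparable, that is, lie on sides of opposite sign of one another. Indexing the
sides by `Bool` makes the reversal of the orientation the substitution `s ↦ !s`. -/
structure SideSystem {T : Type*} [TopologicalSpace T] (S : Bool → T → Set T) : Prop where
  isOpen : ∀ s x, IsOpen (S s x)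
  isPreconnected : ∀ s x, IsPreconnected (S s x)
  self_notMem : ∀ s x, x ∉ S s x
  disj : ∀ {s x y}, y ∈ S s x → y ∉ S (!s) x
  cover : ∀ {x y}, y ≠ x → ∃ s, y ∈ S s x
  mem_closure : ∀ s x, x ∈ closure (S s x)
  basis : ∀ z, ∀ U ∈ 𝓝 z, ∃ J ⊆ U, IsOpen J ∧ z ∈ J ∧ IsPreconnected J ∧
    ∀ a ∈ J, ∀ b ∈ J, a ≠ b → ∃ s, b ∈ S s a ∧ a ∈ S (!s) b

namespace SideSystem

variable {T : Type*} [TopologicalSpace T] {S : Bool → T → Set T} (hS : SideSystem S)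
include hS

theorem ne_of_mem {s : Bool} {x y : T} (h : y ∈ S s x) : y ≠ x := by
  rintro rfl
  exact hS.self_notMem _ _ h

theorem sign_eq {s t : Bool} {x y : T} (h : y ∈ S s x) (h' : y ∈ S t x) : s = t := by
  by_contra hne
  obtain rfl : t = !s := by cases s <;> cases t <;> simp_all
  exact hS.disj h h'

theorem nonempty (s : Bool) (x : T) : (S s x).Nonempty :=
  closure_nonempty_iff.1 ⟨x, hS.mem_closure s x⟩

theorem isPreconnected_insert (s : Bool) (x : T) : IsPreconnected (insert x (S s x)) :=
  (hS.isPreconnected s x).subset_closure (subset_insert _ _)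
    (insert_subset (hS.mem_closure s x) subset_closure)

/-- A connected set that avoids `x` lies on one side of `x`. -/
theorem same_side {C : Set T} (hC : IsPreconnected C) {x a b : T} (hx : x ∉ C) (ha : a ∈ C)
    (hb : b ∈ C) {s : Bool} (h : a ∈ S s x) : b ∈ S s x := by
  refine hC.subset_left_of_subset_union (hS.isOpen s x) (hS.isOpen (!s) x) ?_ ?_ ⟨a, ha, h⟩ hb
  · exact Set.disjoint_left.2 fun y hy => hS.disj hy
  · intro y hy
    obtain ⟨t, ht⟩ := hS.cover (x := x) (y := y) (by rintro rfl; exact hx hy)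
    by_cases hts : t = s
    · exact Or.inl (hts ▸ ht)
    · obtain rfl : t = !s := by cases s <;> cases t <;> simp_all
      exact Or.inr ht

/-- Of two points, the half-space at one that does not contain the other is contained in a
half-space at the other. -/
theorem insert_subset_side {s t : Bool} {a b : T} (h : b ∈ S s a) (h' : a ∈ S t b) :
    insert b (S (!t) b) ⊆ S s a := by
  intro y hy
  refine hS.same_side (hS.isPreconnected_insert (!t) b) ?_ (mem_insert _ _) hy h
  rintro (hab | hab)
  · exact hS.ne_of_mem h' hab
  · exact hS.disj h' hab

theorem side_subset {s t : Bool} {a b : T} (h : b ∈ S s a) (h' : a ∈ S t b) :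
    S (!t) b ⊆ S s a := (subset_insert _ _).trans (hS.insert_subset_side h h')

theorem side_subset' {s t : Bool} {a b : T} (h : b ∈ S s a) (h' : a ∈ S (!t) b) :
    S t b ⊆ S s a := by
  simpa using hS.side_subset h h'

/-! ### Geodesic spines as pretree intervals -/

/-- The spine from `a` to `b` consists of `a`, `b` and the points that separate them; here local
path-connectedness makes the sides path-connected. -/
theorem mem_geodesicSpine_iff [LocallyPathConnectedSpace T] [PathConnectedSpace T] {a b z : T} :
    z ∈ geodesicSpine a b ↔ z = a ∨ z = b ∨ ∃ s, a ∈ S s z ∧ b ∈ S (!s) z := by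
  constructor
  · intro h
    by_contra hcon
    push Not at hcon
    obtain ⟨hza, hzb, hsep⟩ := hcon
    obtain ⟨s, hs⟩ := hS.cover (Ne.symm hza)
    obtain ⟨t, ht⟩ := hS.cover (Ne.symm hzb)
    obtain rfl : t = s := by
      by_contra hne
      obtain rfl : t = !s := by cases s <;> cases t <;> simp_all
      exact hsep s hs ht
    have hpc : IsPathConnected (S t z) :=
      (hS.isOpen t z).isConnected_iff_isPathConnected.1 ⟨⟨a, hs⟩, hS.isPreconnected t z⟩
    obtain ⟨γ, hγ⟩ := hpc.joinedIn a hs b ht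
    obtain ⟨r, hr⟩ := mem_iInter.1 h γ
    exact hS.self_notMem t z (hr ▸ hγ r)
  · rintro (rfl | rfl | ⟨s, ha, hb⟩)
    · exact mem_iInter.2 fun γ => ⟨0, γ.source⟩
    · exact mem_iInter.2 fun γ => ⟨1, γ.target⟩
    · refine mem_iInter.2 fun γ => ?_
      by_contra hz
      exact hS.disj (hS.same_side (isPreconnected_range γ.continuous) hz ⟨0, γ.source⟩
        ⟨1, γ.target⟩ ha) hb

omit hS in
theorem left_mem_spine (a b : T) : a ∈ geodesicSpine a b :=
  mem_iInter.2 fun γ => ⟨0, γ.source⟩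

omit hS in
theorem right_mem_spine (a b : T) : b ∈ geodesicSpine a b :=
  mem_iInter.2 fun γ => ⟨1, γ.target⟩

omit hS in
theorem spine_comm (a b : T) : geodesicSpine a b = geodesicSpine b a := by
  have key : ∀ a b : T, geodesicSpine a b ⊆ geodesicSpine b a := fun a b z hz =>
    mem_iInter.2 fun γ => by simpa [Path.symm_range] using mem_iInter.1 hz γ.symm
  exact (key a b).antisymm (key b a)

omit hS in
theorem spine_self {a z : T} (h : z ∈ geodesicSpine a a) : z = a := by
  simpa using mem_iInter.1 h (Path.refl a)

omit hS in
theorem spine_subset_union (a b c : T) :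
    geodesicSpine a c ⊆ geodesicSpine a b ∪ geodesicSpine b c := by
  intro z hz
  by_contra hcon
  simp only [mem_union, not_or, geodesicSpine, mem_iInter, not_forall] at hcon
  obtain ⟨⟨γ, hγ⟩, ⟨δ, hδ⟩⟩ := hcon
  have := mem_iInter.1 hz (γ.trans δ)
  rw [Path.trans_range] at this
  exact this.elim hγ hδ

variable [LocallyPathConnectedSpace T] [PathConnectedSpace T]

theorem spine_antisymm {a b c : T} (hb : b ∈ geodesicSpine a c) (hc : c ∈ geodesicSpine a b) :
    b = c := by
  rcases hS.mem_geodesicSpine_iff.1 hb with rfl | h | ⟨s, has, hcs⟩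
  · exact (spine_self hc).symm
  · exact h
  rcases hS.mem_geodesicSpine_iff.1 hc with rfl | h | ⟨t, hat, hbt⟩
  · exact spine_self hb
  · exact h.symm
  exact absurd (hS.side_subset' hcs hbt hat) (hS.disj has)

theorem spine_subset_left {a b c : T} (hc : c ∈ geodesicSpine a b) :
    geodesicSpine a c ⊆ geodesicSpine a b := by
  intro e he
  rcases spine_subset_union a b c he with h | h
  · exact h
  rcases spine_subset_union a e b hc with h' | h'
  · rw [hS.spine_antisymm he h']
    exact hc
  · rw [spine_comm] at h'
    rw [hS.spine_antisymm h h']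
    exact hc

/-- Geodesic spines are convex. -/
theorem spine_subset {a b c d : T} (hc : c ∈ geodesicSpine a b) (hd : d ∈ geodesicSpine a b) :
    geodesicSpine c d ⊆ geodesicSpine a b := by
  rcases spine_subset_union a c b hd with h | h
  · rw [spine_comm] at h
    refine (hS.spine_subset_left h).trans ?_
    rw [spine_comm]
    exact hS.spine_subset_left hc
  · refine (hS.spine_subset_left h).trans ?_
    rw [spine_comm, spine_comm a b]
    rw [spine_comm] at hc
    exact hS.spine_subset_left hc

theorem spine_total {a b c d : T} (hc : c ∈ geodesicSpine a b) (hd : d ∈ geodesicSpine a b) :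
    c ∈ geodesicSpine a d ∨ d ∈ geodesicSpine a c := by
  rcases spine_subset_union a c b hd with h | h
  · exact Or.inr h
  rcases spine_subset_union a d b hc with h' | h'
  · exact Or.inl h'
  · rw [spine_comm] at h h'
    rw [hS.spine_antisymm h' h]
    exact Or.inl (right_mem_spine _ _)

theorem spine_subset_of_isPreconnected {J : Set T} (hJ : IsPreconnected J) {a b : T} (ha : a ∈ J)
    (hb : b ∈ J) : geodesicSpine a b ⊆ J := by
  intro z hz
  by_contra hzJ
  rcases hS.mem_geodesicSpine_iff.1 hz with rfl | rfl | ⟨s, has, hbs⟩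
  · exact hzJ ha
  · exact hzJ hb
  · exact hS.disj (hS.same_side hJ hzJ ha hb has) hbs

/-- The union of the geodesic spines between the points of a set is an implicit subtree. -/
theorem isImplicitSubtree_hull {Q : Set T} (hQ : Q.Nonempty) :
    IsImplicitSubtree (⋃ p ∈ Q, ⋃ q ∈ Q, geodesicSpine p q) := by
  refine ⟨?_, ?_⟩
  · obtain ⟨q, hq⟩ := hQ
    exact ⟨q, mem_iUnion₂.2 ⟨q, hq, mem_iUnion₂.2 ⟨q, hq, left_mem_spine q q⟩⟩⟩
  · intro a ha b hb c hc
    simp only [mem_iUnion, exists_prop] at ha hb ⊢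
    obtain ⟨p, hp, q, hq, ha⟩ := ha
    obtain ⟨r, hr, t, ht, hb⟩ := hb
    -- `c` lies on the chain of spines `[a, p]`, `[p, r]`, `[r, b]`.
    rcases spine_subset_union a p b hc with h | h
    · exact ⟨p, hp, q, hq, hS.spine_subset ha (left_mem_spine _ _) h⟩
    rcases spine_subset_union p r b h with h | h
    · exact ⟨p, hp, r, hr, h⟩
    · exact ⟨r, hr, t, ht, hS.spine_subset (left_mem_spine _ _) hb h⟩

end SideSystem

namespace SideSystem

variable {T : Type*} [TopologicalSpace T] {S : Bool → T → Set T} (hS : SideSystem S)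
include hS

/-! ### Turning points on a path -/

/-- If each of `a`, `b` lies on the `s`-side of the other, then some point `z` lies on the `s`-side
of both and has both on its opposite side. A path from `a` to `b` leaves `a` through its `s`-side
and arrives at `b` through its `s`-side, and `z` is found just beyond the place where
the path passes for the last time through a point that separates `a` from `b` in the direction `s`
(or through `a`). -/
theorem exists_common_bound [PathConnectedSpace T] {s : Bool} {a b : T} (hab : b ∈ S s a)
    (hba : a ∈ S s b) :
    ∃ z, z ∈ S s a ∧ a ∈ S (!s) z ∧ z ∈ S s b ∧ b ∈ S (!s) z := by
  by_contra hcon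
  let Q : T → Prop := fun c => c = a ∨ (a ∈ S (!s) c ∧ b ∈ S s c)
  have hQb : ∀ {c}, Q c → b ∈ S s c := by
    rintro c (rfl | h)
    exacts [hab, h.2]
  have hQb' : ∀ {c}, Q c → c ∈ S s b := by
    intro c hc
    rcases hc with rfl | h
    · exact hba
    obtain ⟨t, ht⟩ := hS.cover (x := b) (y := c) (hS.ne_of_mem h.2).symm
    by_cases hts : t = s
    · exact hts ▸ ht
    · obtain rfl : s = !t := by cases s <;> cases t <;> simp_all
      exact absurd (hS.side_subset h.2 ht hba) (hS.disj (by simpa using h.1))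
  -- Inside an oriented interval `J` the property `Q` propagates in the direction `s`.
  have step : ∀ {J : Set T}, IsPreconnected J →
      (∀ x ∈ J, ∀ y ∈ J, x ≠ y → ∃ s, y ∈ S s x ∧ x ∈ S (!s) y) →
      ∀ {c w}, c ∈ J → w ∈ J → Q c → w ∈ S s c → c ∈ S (!s) w → Q w := by
    intro J hJ hJc c w hc hw hQ hwc hcw
    have hbJ : b ∉ J := by
      intro hbJ
      obtain ⟨t, ht, ht'⟩ := hJc c hc b hbJ (hS.ne_of_mem (hQb hQ)).symm
      have := hS.sign_eq ht (hQb hQ)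
      subst this
      exact hS.disj (hQb' hQ) ht'
    have hwb : w ∈ S s b := hS.same_side hJ hbJ hc hw (hQb' hQ)
    have haw : a ∈ S (!s) w := by
      rcases hQ with rfl | h
      · exact hcw
      · exact hS.side_subset' hcw (by simpa using hwc) h.1
    have hwa : w ∈ S s a := by
      rcases hQ with rfl | h
      · exact hwc
      obtain ⟨t, ht⟩ := hS.cover (x := a) (y := c) (hS.ne_of_mem h.1).symm
      have hsub := hS.side_subset' ht h.1
      obtain rfl := hS.sign_eq (hsub h.2) hab
      exact hsub hwc
    obtain ⟨t, ht⟩ := hS.cover (x := w) (y := b) (by rintro rfl; exact hbJ hw)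
    by_cases hts : t = s
    · exact Or.inr ⟨haw, hts ▸ ht⟩
    · obtain rfl : t = !s := by cases s <;> cases t <;> simp_all
      exact absurd ⟨w, hwa, haw, hwb, ht⟩ hcon
  obtain ⟨γ⟩ := PathConnectedSpace.joined a b
  let A : Set unitInterval := {t | Q (γ t)}
  have hA0 : (0 : unitInterval) ∈ A := Or.inl γ.source
  have hlub : IsLUB A (sSup A) := isLUB_sSup A
  set t₀ := sSup A with ht₀
  obtain ⟨J, -, hJo, hzJ, hJ, hJc⟩ := hS.basis (γ t₀) univ univ_mem
  have hnear : ∀ᶠ t in 𝓝 t₀, γ t ∈ J := γ.continuous.continuousAt.eventually (hJo.mem_nhds hzJ)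
  -- After time `t₀` the path does not return to a point with property `Q`.
  have hlast : ∀ {c}, Q c → ∀ {t₁ : unitInterval}, c ∉ γ '' Icc t₁ 1 → γ t₁ ∈ S s c := by
    intro c hc t₁ h
    refine hS.same_side (isPreconnected_Icc.image _ γ.continuous.continuousOn) h
      (mem_image_of_mem _ (right_mem_Icc.2 unitInterval.le_one'))
      (mem_image_of_mem _ (left_mem_Icc.2 unitInterval.le_one')) ?_
    rw [γ.target]
    exact hQb hc
  by_cases hQ : Q (γ t₀)
  · have hlt : t₀ < 1 := by
      refine lt_of_le_of_ne unitInterval.le_one' fun h => ?_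
      have := hQb hQ
      rw [h, γ.target] at this
      exact hS.self_notMem _ _ this
    have hfr : ∃ᶠ t in 𝓝[>] t₀, γ t ∈ J := by
      have : (𝓝[>] t₀).NeBot := nhdsGT_neBot_of_exists_gt ⟨1, hlt⟩
      exact (hnear.filter_mono nhdsWithin_le_nhds).frequently
    obtain ⟨t₁, ht₁J, ht₁⟩ := (hfr.and_eventually self_mem_nhdsWithin).exists
    have hw : γ t₁ ∈ S s (γ t₀) := by
      refine hlast hQ ?_
      rintro ⟨t, ht, hte⟩
      have : Q (γ t) := by rw [hte]; exact hQ
      exact absurd (hlub.1 this) (not_le.2 (lt_of_lt_of_le ht₁ ht.1))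
    obtain ⟨t, ht, ht'⟩ := hJc _ hzJ _ ht₁J (hS.ne_of_mem hw).symm
    obtain rfl := hS.sign_eq ht hw
    exact absurd (hlub.1 (step hJ hJc hzJ ht₁J hQ hw ht')) (not_le.2 ht₁)
  · have hfr := (hlub.frequently_mem ⟨0, hA0⟩).and_eventually
      (hnear.filter_mono nhdsWithin_le_nhds)
    obtain ⟨t, htA, htJ⟩ := hfr.exists
    have hne : γ t ≠ γ t₀ := fun h => hQ (h ▸ htA)
    have hw : γ t₀ ∈ S s (γ t) := by
      refine hlast htA ?_
      rintro ⟨t', ht', hte⟩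
      have hQt' : Q (γ t') := by rw [hte]; exact htA
      obtain rfl := le_antisymm (hlub.1 hQt') ht'.1
      exact hQ hQt'
    obtain ⟨r, hr, hr'⟩ := hJc _ htJ _ hzJ hne
    obtain rfl := hS.sign_eq hr hw
    exact hQ (step hJ hJc htJ hzJ htA hw hr')

variable [LocallyPathConnectedSpace T] [PathConnectedSpace T]

/-! ### Rays and ends -/

theorem mem_spine_of_monotone {y : T} {u : ℕ → T}
    (hu : ∀ i j, i ≤ j → geodesicSpine y (u i) ⊆ geodesicSpine y (u j)) {i m j : ℕ} (him : i ≤ m)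
    (hmj : m ≤ j) : u m ∈ geodesicSpine (u i) (u j) := by
  have hi : u i ∈ geodesicSpine y (u m) := hu _ _ him (right_mem_spine _ _)
  have hm : u m ∈ geodesicSpine y (u j) := hu _ _ hmj (right_mem_spine _ _)
  rcases spine_subset_union y (u i) (u j) hm with h | h
  · rw [hS.spine_antisymm h hi]
    exact left_mem_spine _ _
  · exact h

/-- A monotone sequence inside a geodesic spine converges, by compactness of a path. -/
theorem exists_tendsto_of_monotone {y c d : T} {u : ℕ → T}
    (hu : ∀ i j, i ≤ j → geodesicSpine y (u i) ⊆ geodesicSpine y (u j))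
    (hb : ∀ i, u i ∈ geodesicSpine c d) : ∃ a, Tendsto u atTop (𝓝 a) := by
  obtain ⟨γ⟩ := PathConnectedSpace.joined c d
  have hγ : ∀ i, ∃ t, γ t = u i := fun i => mem_iInter.1 (hb i) γ
  choose t ht using hγ
  obtain ⟨t₀, φ, hφ, hlim⟩ := CompactSpace.tendsto_subseq t
  refine ⟨γ t₀, fun U hU => ?_⟩
  obtain ⟨J, hJU, hJo, hzJ, hJ, -⟩ := hS.basis _ U hU
  have h1 : ∀ᶠ n in atTop, γ (t (φ n)) ∈ J :=
    ((γ.continuous.tendsto t₀).comp hlim).eventually (hJo.mem_nhds hzJ)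
  obtain ⟨N, hN⟩ := eventually_atTop.1 h1
  refine mem_map.2 (mem_atTop_sets.2 ⟨φ N, fun m hm => hJU ?_⟩)
  have hmem := hS.mem_spine_of_monotone hu hm ((le_max_left m N).trans (hφ.id_le (max m N)))
  refine hS.spine_subset_of_isPreconnected hJ ?_ ?_ hmem
  · rw [← ht]; exact hN N le_rfl
  · rw [← ht]; exact hN _ (le_max_right _ _)

omit hS in
/-- The sequence `u` of points defines an infinite ray from `y`. -/
def IsRaySeq (y : T) (u : ℕ → T) : Prop :=
  (∀ i j, i ≤ j → geodesicSpine y (u i) ⊆ geodesicSpine y (u j)) ∧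
    ¬ ∃ a, Tendsto u atTop (𝓝 a)

omit hS [LocallyPathConnectedSpace T] [PathConnectedSpace T] in
theorem isInfiniteRay_iff {ρ : Set T} :
    IsInfiniteRay ρ ↔ ∃ y u, IsRaySeq y u ∧ ρ = ⋃ i, geodesicSpine y (u i) := by
  constructor
  · rintro ⟨y, u, hu, hρ, hlim⟩
    refine ⟨y, u, ⟨fun i j hij => ?_, hlim⟩, hρ⟩
    rcases hij.eq_or_lt with rfl | h
    exacts [subset_rfl, hu i j h]
  · rintro ⟨y, u, ⟨hu, hlim⟩, hρ⟩
    exact ⟨y, u, fun i j hij => hu i j hij.le, hρ, hlim⟩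

theorem isRaySeq_tail {y : T} {u : ℕ → T} (hu : IsRaySeq y u) (M : ℕ) :
    IsRaySeq (u M) (fun n => u (n + M)) := by
  refine ⟨fun i j hij => hS.spine_subset_left
    (hS.mem_spine_of_monotone hu.1 (by lia) (by lia)), ?_⟩
  rintro ⟨a, ha⟩
  exact hu.2 ⟨a, (tendsto_add_atTop_iff_nat M).1 ha⟩

theorem isInfiniteRay_tail {y : T} {u : ℕ → T} (hu : IsRaySeq y u) (M : ℕ) :
    IsInfiniteRay (⋃ n, geodesicSpine (u M) (u (n + M))) :=
  isInfiniteRay_iff.2 ⟨_, _, hS.isRaySeq_tail hu M, rfl⟩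

theorem tail_subset {y : T} {u : ℕ → T} (hu : IsRaySeq y u) {M N : ℕ} (h : M ≤ N) :
    ⋃ n, geodesicSpine (u N) (u (n + N)) ⊆ ⋃ n, geodesicSpine (u M) (u (n + M)) := by
  refine iUnion_subset fun n => ?_
  refine subset_iUnion_of_subset (n + N - M) ?_
  have e : n + N - M + M = n + N := by lia
  rw [e]
  exact hS.spine_subset (hS.mem_spine_of_monotone hu.1 h (by lia)) (right_mem_spine _ _)

/-- A ray contained in a ray contains a tail of it. -/
theorem exists_tail_subset {y : T} {u : ℕ → T} (hu : IsRaySeq y u) {τ : Set T}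
    (hτ : IsInfiniteRay τ) (hτu : τ ⊆ ⋃ i, geodesicSpine y (u i)) :
    ∃ M, ⋃ n, geodesicSpine (u M) (u (n + M)) ⊆ τ := by
  obtain ⟨z, v, hv, rfl⟩ := isInfiniteRay_iff.1 hτ
  obtain ⟨M, hM⟩ := mem_iUnion.1 (hτu (mem_iUnion.2 ⟨0, left_mem_spine z (v 0)⟩))
  refine ⟨M, iUnion_subset fun n => ?_⟩
  -- The points `v i` are not confined to the spine from `y` to `u (n + M)`.
  obtain ⟨i, hi⟩ : ∃ i, v i ∉ geodesicSpine y (u (n + M)) := by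
    by_contra! h
    exact hv.2 (hS.exists_tendsto_of_monotone hv.1 h)
  obtain ⟨N, hN⟩ := mem_iUnion.1 (hτu (mem_iUnion.2 ⟨i, right_mem_spine z (v i)⟩))
  have hNn : n + M ≤ N := by
    by_contra h
    exact hi (hu.1 _ _ (by lia) hN)
  have hun : u (n + M) ∈ geodesicSpine y (v i) :=
    (hS.spine_total hN (hu.1 _ _ hNn (right_mem_spine _ _))).resolve_left hi
  have huM : u M ∈ geodesicSpine y (v i) :=
    hS.spine_subset_left hun (hu.1 _ _ (by lia) (right_mem_spine _ _))
  have key : ∀ {c}, c ∈ geodesicSpine y (v i) → z ∈ geodesicSpine y c →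
      c ∈ geodesicSpine z (v i) := by
    intro c hc hz
    rcases spine_subset_union y z (v i) hc with h | h
    · rw [hS.spine_antisymm h hz]
      exact left_mem_spine _ _
    · exact h
  refine subset_iUnion_of_subset i (hS.spine_subset (key huM hM) (key hun ?_))
  exact hu.1 _ _ (by lia) hM

omit hS [LocallyPathConnectedSpace T] [PathConnectedSpace T] in
theorem rayEquiv_symm {ρ ρ' : Set T} (h : RayEquiv ρ ρ') : RayEquiv ρ' ρ := by
  obtain ⟨τ, hτ, hs⟩ := h
  exact ⟨τ, hτ, by rwa [inter_comm]⟩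

theorem rayEquiv_trans {ρ₁ ρ₂ ρ₃ : Set T} (h₂ : IsInfiniteRay ρ₂) (h : RayEquiv ρ₁ ρ₂)
    (h' : RayEquiv ρ₂ ρ₃) : RayEquiv ρ₁ ρ₃ := by
  obtain ⟨y, u, hu, rfl⟩ := isInfiniteRay_iff.1 h₂
  obtain ⟨τ, hτ, hs⟩ := h
  obtain ⟨τ', hτ', hs'⟩ := h'
  obtain ⟨M, hM⟩ := hS.exists_tail_subset hu hτ (fun x hx => (hs hx).2)
  obtain ⟨N, hN⟩ := hS.exists_tail_subset hu hτ' (fun x hx => (hs' hx).1)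
  refine ⟨_, hS.isInfiniteRay_tail hu (max M N), fun x hx => ⟨?_, ?_⟩⟩
  · exact (hs (hM (hS.tail_subset hu (le_max_left M N) hx))).1
  · exact (hs' (hN (hS.tail_subset hu (le_max_right M N) hx))).2

theorem end_eq {ε : Set (Set T)} (hε : IsEnd ε) {ρ : Set T} (hρ : ρ ∈ ε) :
    ε = {ρ' | IsInfiniteRay ρ' ∧ RayEquiv ρ ρ'} := by
  obtain ⟨ρ₀, h₀, rfl⟩ := hε
  ext σ
  exact ⟨fun h => ⟨h.1, hS.rayEquiv_trans h₀ (rayEquiv_symm hρ.2) h.2⟩,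
    fun h => ⟨h.1, hS.rayEquiv_trans hρ.1 hρ.2 h.2⟩⟩

/-- Every end has, for each point `p`, a representative on one side of `p`. -/
theorem exists_mem_end_subset_side {ε : Set (Set T)} (hε : IsEnd ε) (p : T) :
    ∃ s, ∃ ρ ∈ ε, ρ ⊆ S s p := by
  obtain ⟨ρ₀, h₀, rfl⟩ := hε
  obtain ⟨y, u, hu, rfl⟩ := isInfiniteRay_iff.1 h₀
  -- `p` does not lie on some tail.
  obtain ⟨M, hM⟩ : ∃ M, p ∉ ⋃ n, geodesicSpine (u M) (u (n + M)) := by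
    by_contra! hcon
    refine hu.2 (hS.exists_tendsto_of_monotone (c := y) (d := p) hu.1 fun i => ?_)
    obtain ⟨n, hn⟩ := mem_iUnion.1 (hcon i)
    have h1 : u i ∈ geodesicSpine y (u (n + i)) := hu.1 _ _ (by lia) (right_mem_spine _ _)
    have h2 : p ∈ geodesicSpine y (u (n + i)) := by
      rw [spine_comm]
      rw [spine_comm] at h1 hn
      exact hS.spine_subset_left h1 hn
    rcases hS.spine_total h1 h2 with h | h
    · exact h
    · rw [spine_comm] at h hn h1
      rcases spine_subset_union y p (u (n + i)) (by rw [spine_comm]; exact h1) with h' | h'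
      · exact h'
      · rw [spine_comm] at h'
        rw [hS.spine_antisymm h' hn]
        exact right_mem_spine _ _
  have hne : u M ≠ p := by
    rintro rfl
    exact hM (mem_iUnion.2 ⟨0, left_mem_spine _ _⟩)
  obtain ⟨s, hs⟩ := hS.cover hne
  have hray := hS.isInfiniteRay_tail hu M
  refine ⟨s, _, ⟨hray, _, hray, subset_inter (iUnion_subset fun n => ?_) subset_rfl⟩, ?_⟩
  · refine subset_iUnion_of_subset (n + M) (hS.spine_subset ?_ (right_mem_spine _ _))
    exact hu.1 _ _ (by lia) (right_mem_spine _ _)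
  · refine iUnion_subset fun n z hz => ?_
    by_contra hzs
    have hzp : z ≠ p := by
      rintro rfl
      exact hM (mem_iUnion.2 ⟨n, hz⟩)
    obtain ⟨t, ht⟩ := hS.cover hzp
    obtain rfl : t = !s := by
      by_contra hne
      obtain rfl : t = s := by cases s <;> cases t <;> simp_all
      exact hzs ht
    have hp : p ∈ geodesicSpine (u M) z := hS.mem_geodesicSpine_iff.2 (Or.inr (Or.inr ⟨s, hs, ht⟩))
    exact hM (mem_iUnion.2 ⟨n, hS.spine_subset_left hz hp⟩)

end SideSystem

namespace SideSystem

variable {T : Type*} [TopologicalSpace T] {S : Bool → T → Set T} (hS : SideSystem S)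
  {G : Type*} [Group G] [MulAction G T]

/-! ### Orbits of a minimal action -/

variable (S G) in
/-- The group acts by permuting the sides, without exchanging upper and lower ones. -/
def Equivariant : Prop := ∀ (g : G) (s : Bool) (x y : T), y ∈ S s x → g • y ∈ S s (g • x)

variable (he : Equivariant S G)
include hS

omit [TopologicalSpace T] hS in
include he in
theorem Equivariant.mem_side_inv {g : G} {s : Bool} {x y : T} (h : g • y ∈ S s x) :
    y ∈ S s (g⁻¹ • x) := by
  simpa using he g⁻¹ s _ _ h

variable [LocallyPathConnectedSpace T] [PathConnectedSpace T]

include he in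
theorem smul_mem_spine (g : G) {a b z : T} (hz : z ∈ geodesicSpine a b) :
    g • z ∈ geodesicSpine (g • a) (g • b) := by
  rcases hS.mem_geodesicSpine_iff.1 hz with rfl | rfl | ⟨s, h, h'⟩
  · exact left_mem_spine _ _
  · exact right_mem_spine _ _
  · exact hS.mem_geodesicSpine_iff.2 (Or.inr (Or.inr ⟨s, he g _ _ _ h, he g _ _ _ h'⟩))

include he in
theorem image_spine (g : G) (a b : T) :
    (fun x : T => g • x) '' geodesicSpine a b = geodesicSpine (g • a) (g • b) := by
  ext z
  constructor
  · rintro ⟨w, hw, rfl⟩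
    exact hS.smul_mem_spine he g hw
  · intro hz
    exact ⟨g⁻¹ • z, by simpa using hS.smul_mem_spine he g⁻¹ hz, smul_inv_smul g z⟩

include he in
theorem isInfiniteRay_image [ContinuousConstSMul G T] (g : G) {ρ : Set T}
    (h : IsInfiniteRay ρ) : IsInfiniteRay ((fun x : T => g • x) '' ρ) := by
  obtain ⟨y, u, hu, rfl, hlim⟩ := h
  refine ⟨g • y, fun n => g • u n, fun i j hij => ?_, ?_, ?_⟩
  · rw [← hS.image_spine he, ← hS.image_spine he]
    exact image_mono (hu i j hij)
  · rw [image_iUnion]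
    exact iUnion_congr fun i => hS.image_spine he g _ _
  · rintro ⟨a, ha⟩
    exact hlim ⟨g⁻¹ • a, by simpa using ha.const_smul g⁻¹⟩

include he in
theorem rayEquiv_image [ContinuousConstSMul G T] (g : G) {ρ ρ' : Set T} (h : RayEquiv ρ ρ') :
    RayEquiv ((fun x : T => g • x) '' ρ) ((fun x : T => g • x) '' ρ') := by
  obtain ⟨τ, hτ, hsub⟩ := h
  exact ⟨_, hS.isInfiniteRay_image he g hτ, subset_inter
    (image_mono fun x hx => (hsub hx).1) (image_mono fun x hx => (hsub hx).2)⟩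

include he in
/-- For a minimal action every orbit meets every half-space: the union of the spines
between the points of the orbit is an invariant implicit subtree. -/
theorem exists_smul_mem_side (hmin : IsMinimalTreeAction T G) (x p : T) (s : Bool) :
    ∃ g : G, g • x ∈ S s p := by
  by_contra! hcon
  have huniv := hmin _ (hS.isImplicitSubtree_hull (Q := range fun g : G => g • x)
    ⟨_, ⟨1, rfl⟩⟩) (by
      intro g z hz
      simp only [mem_iUnion, exists_prop, exists_range_iff] at hz ⊢
      obtain ⟨a, b, hz⟩ := hz
      exact ⟨g * a, g * b, by simpa [mul_smul] using hS.smul_mem_spine he g hz⟩)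
  obtain ⟨w, hw⟩ := hS.nonempty s p
  have hw' : w ∈ (univ : Set T) := mem_univ w
  rw [← huniv] at hw'
  simp only [mem_iUnion, exists_prop, exists_range_iff] at hw'
  obtain ⟨a, b, hab⟩ := hw'
  have hside : ∀ g : G, g • x ∈ insert p (S (!s) p) := by
    intro g
    by_cases hg : g • x = p
    · exact Or.inl hg
    obtain ⟨t, ht⟩ := hS.cover hg
    by_cases hts : t = s
    · exact absurd (hts ▸ ht) (hcon g)
    · obtain rfl : t = !s := by cases s <;> cases t <;> simp_all
      exact Or.inr ht
  rcases hS.spine_subset_of_isPreconnected (hS.isPreconnected_insert _ _) (hside a) (hside b) hab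
    with h | h
  · exact hS.ne_of_mem hw h
  · exact hS.disj hw h

/-! ### Orbits with incomparable pairs of both kinds -/

include he in
/-- If the orbit has incomparable pairs of both signs, every half-space contains half-spaces of
both signs at orbit points. -/
theorem exists_smul_side_subset (hmin : IsMinimalTreeAction T G) {x : T}
    (hpair : ∀ s, ∃ g h : G, h • x ∈ S s (g • x) ∧ g • x ∈ S s (h • x)) (t s : Bool) (p : T) :
    ∃ k : G, k • x ∈ S t p ∧ p ∈ S (!s) (k • x) := by
  obtain ⟨k, hk⟩ := hS.exists_smul_mem_side he hmin x p t
  obtain ⟨r, hr⟩ := hS.cover (hS.ne_of_mem hk).symm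
  by_cases hrs : r = s
  · subst hrs
    -- `k • x` faces away from `p`; a pair of sign `!r` provides a translate beyond it that does not.
    obtain ⟨g, h, h1, h2⟩ := hpair (!r)
    have h1' : (k * g⁻¹ * h) • x ∈ S (!r) (k • x) := by
      simpa [mul_smul] using he (k * g⁻¹) _ _ _ h1
    have h2' : k • x ∈ S (!r) ((k * g⁻¹ * h) • x) := by
      simpa [mul_smul] using he (k * g⁻¹) _ _ _ h2
    exact ⟨k * g⁻¹ * h, hS.side_subset hk hr h1', hS.side_subset h2' h1' (by simpa using hr)⟩
  · obtain rfl : r = !s := by cases s <;> cases r <;> simp_all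
    exact ⟨k, hk, hr⟩

include he in
theorem exists_smul_common_bound (hmin : IsMinimalTreeAction T G) {x : T}
    (hpair : ∀ s, ∃ g h : G, h • x ∈ S s (g • x) ∧ g • x ∈ S s (h • x)) {s : Bool} {a b : T}
    (hab : b ∈ S s a) (hba : a ∈ S s b) :
    ∃ k : G, k • x ∈ S s a ∧ a ∈ S (!s) (k • x) ∧ k • x ∈ S s b ∧ b ∈ S (!s) (k • x) := by
  obtain ⟨z, hza, haz, hzb, hbz⟩ := hS.exists_common_bound hab hba
  obtain ⟨k, hk, hk'⟩ := hS.exists_smul_side_subset he hmin hpair s s z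
  have hsub : S (!s) z ⊆ S (!s) (k • x) := hS.side_subset' hk' (by simpa using hk)
  exact ⟨k, hS.side_subset' hza haz hk, hsub haz, hS.side_subset' hzb hbz hk, hsub hbz⟩

/-! ### Orbits with incomparable pairs of only one kind -/

theorem ray_convex {ρ : Set T} (h : IsInfiniteRay ρ) {a b : T} (ha : a ∈ ρ) (hb : b ∈ ρ) :
    geodesicSpine a b ⊆ ρ := by
  obtain ⟨y, u, hu, rfl⟩ := isInfiniteRay_iff.1 h
  obtain ⟨i, hi⟩ := mem_iUnion.1 ha
  obtain ⟨j, hj⟩ := mem_iUnion.1 hb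
  exact subset_iUnion_of_subset (max i j) (hS.spine_subset (hu.1 _ _ (le_max_left i j) hi)
    (hu.1 _ _ (le_max_right i j) hj))

section OneKind

variable {s : Bool} {x : T}
  (hno : ∀ g h : G, h • x ∈ S (!s) (g • x) → g • x ∉ S (!s) (h • x))

omit [LocallyPathConnectedSpace T] [PathConnectedSpace T] in
include hno in
/-- If no two orbit points are on the `!s`-sides of each other, an orbit point with another one on
its `!s`-side is on the `s`-side of the latter. -/
theorem mem_side_of_mem_side {g k : G} (h : g • x ∈ S (!s) (k • x)) : k • x ∈ S s (g • x) := by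
  obtain ⟨t, ht⟩ := hS.cover (hS.ne_of_mem h).symm
  by_cases hts : t = s
  · exact hts ▸ ht
  · obtain rfl : t = !s := by cases s <;> cases t <;> simp_all
    exact absurd h (hno _ _ ht)

include hno he in
/-- If no two points of the orbit lie on the `!s`-sides of each other, then the `!s`-sides of the
orbit points form a directed cover of the space. -/
theorem exists_smul_mem_mem (hmin : IsMinimalTreeAction T G) (z w : T) :
    ∃ k : G, z ∈ S (!s) (k • x) ∧ w ∈ S (!s) (k • x) := by
  have hcov : ∀ z, ∃ g : G, z ∈ S (!s) (g • x) := by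
    intro z
    obtain ⟨g, hg⟩ := hS.exists_smul_mem_side he hmin z x (!s)
    exact ⟨g⁻¹, he.mem_side_inv hg⟩
  let V : Set T := {w | ∃ k : G, z ∈ S (!s) (k • x) ∧ w ∈ S (!s) (k • x)}
  suffices hV : V = univ from (hV ▸ mem_univ w : w ∈ V)
  refine IsClopen.eq_univ ⟨⟨?_⟩, ?_⟩ ?_
  · refine isOpen_iff_mem_nhds.2 fun w hw => ?_
    obtain ⟨g, hg⟩ := hcov w
    refine mem_of_superset ((hS.isOpen _ _).mem_nhds hg) ?_
    rintro w' hw' ⟨k, hzk, hwk⟩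
    -- Two overlapping `!s`-sides of orbit points are nested.
    by_cases hgk : k • x = g • x
    · exact hw ⟨k, hzk, hgk ▸ hg⟩
    obtain ⟨t, ht⟩ := hS.cover hgk
    obtain ⟨r, hr⟩ := hS.cover (Ne.symm hgk)
    have hcase : t = !s ∨ r = !s := by
      by_contra! h
      obtain rfl : t = s := by cases s <;> cases t <;> simp_all
      obtain rfl : r = t := by cases t <;> cases r <;> simp_all
      exact hS.disj (hS.side_subset ht hr hwk) hw'
    rcases hcase with rfl | rfl
    · have h' := hS.mem_side_of_mem_side hno ht
      exact hw ⟨g, hS.side_subset' ht (by simpa using h') hzk, hg⟩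
    · have h' := hS.mem_side_of_mem_side hno hr
      exact hw ⟨k, hzk, hS.side_subset' hr (by simpa using h') hg⟩
  · refine isOpen_iff_mem_nhds.2 ?_
    rintro w ⟨k, hzk, hwk⟩
    exact mem_of_superset ((hS.isOpen _ _).mem_nhds hwk) fun w' hw' => ⟨k, hzk, hw'⟩
  · obtain ⟨g, hg⟩ := hcov z
    exact ⟨z, g, hg, hg⟩

include hno he in
/-- A sequence of orbit points, each beyond the previous one, whose `!s`-sides exhaust
the space. -/
theorem exists_exhausting_seq [Countable G] (hmin : IsMinimalTreeAction T G) :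
    ∃ k : ℕ → G, (∀ i j, i < j → k i • x ∈ S (!s) (k j • x)) ∧
      (∀ i j, i ≤ j → S (!s) (k i • x) ⊆ S (!s) (k j • x)) ∧
      ∀ z, ∃ n, z ∈ S (!s) (k n • x) := by
  obtain ⟨e, hsurj⟩ := exists_surjective_nat G
  choose m hm1 hm2 using fun g h : G =>
    hS.exists_smul_mem_mem he hno hmin (g • x) (h • x)
  let k : ℕ → G := fun n => Nat.rec 1 (fun n g => m g (e n)) n
  have hsub : ∀ {g h : G}, g • x ∈ S (!s) (h • x) → S (!s) (g • x) ⊆ S (!s) (h • x) :=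
    fun h => hS.side_subset' h (by simpa using hS.mem_side_of_mem_side hno h)
  have hmono : ∀ i j, i ≤ j → S (!s) (k i • x) ⊆ S (!s) (k j • x) := fun i j hij =>
    monotone_nat_of_le_succ (f := fun n => S (!s) (k n • x)) (fun n => hsub (hm1 (k n) (e n))) hij
  refine ⟨k, fun i j hij => hmono (i + 1) j hij (hm1 (k i) (e i)), hmono, fun z => ?_⟩
  obtain ⟨g, hg, -⟩ := hS.exists_smul_mem_mem he hno hmin z z
  obtain ⟨n, rfl⟩ := hsurj g
  exact ⟨n + 1, hsub (hm2 (k n) (e n)) hg⟩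

include hno he in
/-- An orbit whose incomparable pairs all have the same sign, and which has such a pair, forces
exactly one end to be fixed: the end to which the exhausting sequence converges. -/
theorem existsUnique_fixed_end [Countable G] [ContinuousConstSMul G T]
    (hmin : IsMinimalTreeAction T G)
    (hpair : ∃ g h : G, h • x ∈ S s (g • x) ∧ g • x ∈ S s (h • x)) :
    ∃! ε : Set (Set T), IsEnd ε ∧ FixesEnd G ε := by
  obtain ⟨k, hk, hmono, hex⟩ := hS.exists_exhausting_seq he hno hmin
  have hk' : ∀ i j, i < j → k j • x ∈ S s (k i • x) := fun i j hij =>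
    hS.mem_side_of_mem_side hno (hk i j hij)
  have hbtw : ∀ {z : T} {n j : ℕ}, z ∈ S (!s) (k n • x) → n ≤ j →
      k n • x ∈ geodesicSpine z (k j • x) := by
    intro z n j hz hnj
    rcases hnj.eq_or_lt with rfl | h
    · exact right_mem_spine _ _
    · exact hS.mem_geodesicSpine_iff.2 (Or.inr (Or.inr ⟨_, hz, by simpa using hk' _ _ h⟩))
  have hseq : IsRaySeq (k 0 • x) (fun n => k n • x) := by
    refine ⟨fun i j hij => hS.spine_subset_left ?_, ?_⟩
    · rcases Nat.eq_zero_or_pos i with rfl | hi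
      · exact left_mem_spine _ _
      · exact hbtw (hk _ _ hi) hij
    · rintro ⟨a, ha⟩
      obtain ⟨n, hn⟩ := hex a
      obtain ⟨j, hj, hnj⟩ := ((ha.eventually ((hS.isOpen _ _).mem_nhds hn)).and
        (eventually_gt_atTop n)).exists
      exact hS.disj (hk' n j hnj) hj
  set ρ : Set T := ⋃ n, geodesicSpine (k 0 • x) (k n • x) with hρdef
  have hρ : IsInfiniteRay ρ := isInfiniteRay_iff.2 ⟨_, _, hseq, rfl⟩
  have hkρ : ∀ n, k n • x ∈ ρ := fun n => mem_iUnion.2 ⟨n, right_mem_spine _ _⟩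
  -- A ray through all but finitely many points of the sequence is equivalent to `ρ`.
  have hequiv : ∀ {σ : Set T}, IsInfiniteRay σ → ∀ N, (∀ n, N ≤ n → k n • x ∈ σ) →
      RayEquiv ρ σ := by
    intro σ hσ N hN
    refine ⟨_, hS.isInfiniteRay_tail hseq N, iUnion_subset fun n => subset_inter ?_ ?_⟩
    · exact hS.ray_convex hρ (hkρ _) (hkρ _)
    · exact hS.ray_convex hσ (hN _ le_rfl) (hN _ (by lia))
  set ε : Set (Set T) := {ρ' | IsInfiniteRay ρ' ∧ RayEquiv ρ ρ'} with hεdef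
  have hε : IsEnd ε := ⟨ρ, hρ, rfl⟩
  have hgρ : ∀ g : G, RayEquiv ρ ((fun x : T => g • x) '' ρ) := by
    intro g
    obtain ⟨N, hN⟩ := hex (g • k 0 • x)
    refine hequiv (hS.isInfiniteRay_image he g hρ) N fun n hn => ?_
    obtain ⟨j, hj⟩ := hex (g⁻¹ • k n • x)
    have hj' : k n • x ∈ S (!s) ((g * k j) • x) := by
      simpa [mul_smul] using he g _ _ _ hj
    have hmem : k n • x ∈ geodesicSpine (g • k 0 • x) (g • k j • x) := by
      refine hS.mem_geodesicSpine_iff.2 (Or.inr (Or.inr ⟨_, hmono _ _ hn hN, ?_⟩))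
      simpa [mul_smul] using hS.mem_side_of_mem_side hno hj'
    rw [← hS.image_spine he] at hmem
    exact image_mono (subset_iUnion (fun n => geodesicSpine (k 0 • x) (k n • x)) j) hmem
  have hsub : ∀ (g : G) {σ}, σ ∈ ε → (fun x : T => g • x) '' σ ∈ ε := by
    intro g σ hσ
    exact ⟨hS.isInfiniteRay_image he g hσ.1, hS.rayEquiv_trans
      (hS.isInfiniteRay_image he g hρ) (hgρ g) (hS.rayEquiv_image he g hσ.2)⟩
  refine ⟨ε, ⟨hε, fun g => ?_⟩, ?_⟩
  · refine Subset.antisymm ?_ ?_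
    · rintro _ ⟨σ, hσ, rfl⟩
      exact hsub g hσ
    · intro σ hσ
      refine ⟨_, hsub g⁻¹ hσ, ?_⟩
      simp [image_image]
  · rintro ε' ⟨hε', hfix⟩
    have hmeet : ∀ {σ τ}, σ ∈ ε' → τ ∈ ε' → (σ ∩ τ).Nonempty := by
      intro σ τ hσ hτ
      have hτ' := hτ
      rw [hS.end_eq hε' hσ] at hτ'
      obtain ⟨κ, ⟨y, u, -, rfl, -⟩, hκ⟩ := hτ'.2
      exact ⟨y, hκ (mem_iUnion.2 ⟨0, left_mem_spine _ _⟩)⟩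
    -- All orbit points are on the same side of `ε'`.
    obtain ⟨t, σ₀, hσ₀, hσ₀t⟩ := hS.exists_mem_end_subset_side hε' x
    have hall : ∀ g : G, ∃ σ ∈ ε', σ ⊆ S t (g • x) := by
      intro g
      refine ⟨_, by rw [← hfix g]; exact ⟨σ₀, hσ₀, rfl⟩, ?_⟩
      rintro _ ⟨z, hz, rfl⟩
      exact he g _ _ _ (hσ₀t hz)
    by_cases hts : t = s
    · subst hts
      obtain ⟨y, u, hu, hσu⟩ := isInfiniteRay_iff.1 (show IsInfiniteRay σ₀ by
        rw [hS.end_eq hε' hσ₀] at hσ₀; exact hσ₀.1)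
      have hσ₀ray : IsInfiniteRay σ₀ := isInfiniteRay_iff.2 ⟨y, u, hu, hσu⟩
      have hyσ : y ∈ σ₀ := hσu ▸ mem_iUnion.2 ⟨0, left_mem_spine _ _⟩
      obtain ⟨N, hN⟩ := hex y
      have heq : RayEquiv ρ σ₀ := hequiv hσ₀ray N fun n hn => by
        obtain ⟨σ, hσ, hσn⟩ := hall (k n)
        obtain ⟨v, hv, hv'⟩ := hmeet hσ₀ hσ
        exact hS.ray_convex hσ₀ray hyσ hv (hS.mem_geodesicSpine_iff.2
          (Or.inr (Or.inr ⟨_, hmono _ _ hn hN, by simpa using hσn hv'⟩)))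
      rw [hS.end_eq hε ⟨hσ₀ray, heq⟩, hS.end_eq hε' hσ₀]
    · obtain rfl : t = !s := by cases s <;> cases t <;> simp_all
      obtain ⟨g, h, h1, h2⟩ := hpair
      obtain ⟨σ, hσ, hσg⟩ := hall g
      obtain ⟨τ, hτ, hτh⟩ := hall h
      obtain ⟨v, hv, hv'⟩ := hmeet hσ hτ
      exact absurd (hσg hv) (hS.disj (hS.side_subset h1 h2 (hτh hv')))

end OneKind

end SideSystem

namespace SideSystem

variable {T : Type*} [TopologicalSpace T] {S : Bool → T → Set T} (hS : SideSystem S)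
include hS

/-! ### The order induced on a set of points -/

theorem side_subset_side_iff {s : Bool} {p q : T} (hpq : p ≠ q) :
    S s q ⊆ S s p ↔ q ∈ S s p ∧ p ∈ S (!s) q := by
  constructor
  · intro h
    have hq : q ∈ S s p := by
      obtain ⟨t, ht⟩ := hS.cover hpq.symm
      by_cases hts : t = s
      · exact hts ▸ ht
      · obtain rfl : t = !s := by cases s <;> cases t <;> simp_all
        obtain ⟨w, hw, hw'⟩ := mem_closure_iff.1 (hS.mem_closure s q) _ (hS.isOpen _ _) ht
        exact absurd hw (hS.disj (h hw'))
    obtain ⟨t, ht⟩ := hS.cover hpq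
    by_cases hts : t = s
    · subst hts
      exact absurd (h ht) (hS.self_notMem _ _)
    · obtain rfl : t = !s := by cases s <;> cases t <;> simp_all
      exact ⟨hq, ht⟩
  · rintro ⟨h, h'⟩
    exact hS.side_subset' h h'

variable {α : Type*} [PartialOrder α] {f : α → T} (hf : Function.Injective f)
  (hle : ∀ a b, a ≤ b ↔ S true (f b) ⊆ S true (f a))

include hf hle

theorem lt_iff {a b : α} : a < b ↔ f b ∈ S true (f a) ∧ f a ∈ S false (f b) := by
  constructor
  · intro h
    exact (hS.side_subset_side_iff (hf.ne h.ne)).1 ((hle _ _).1 h.le)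
  · intro h
    have hne : f a ≠ f b := (hS.ne_of_mem h.1).symm
    exact lt_of_le_of_ne ((hle _ _).2 ((hS.side_subset_side_iff hne).2 h))
      fun e => hne (congrArg f e)

theorem incompRel_iff {a b : α} :
    IncompRel (· ≤ ·) a b ↔ ∃ s, f b ∈ S s (f a) ∧ f a ∈ S s (f b) := by
  constructor
  · intro h
    have hne : f b ≠ f a := fun e => h.1 (hf e ▸ le_rfl)
    obtain ⟨s, hs⟩ := hS.cover hne
    obtain ⟨t, ht⟩ := hS.cover hne.symm
    by_cases hst : s = t
    · exact ⟨t, hst ▸ hs, ht⟩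
    · cases s <;> cases t
      · exact absurd rfl hst
      · exact absurd ((hS.lt_iff hf hle).2 ⟨ht, hs⟩).le h.2
      · exact absurd ((hS.lt_iff hf hle).2 ⟨hs, ht⟩).le h.1
      · exact absurd rfl hst
  · rintro ⟨s, h1, h2⟩
    have hne : a ≠ b := fun e => hS.ne_of_mem h1 (congrArg f e.symm)
    constructor
    · intro h
      have h' := (hS.lt_iff hf hle).1 (lt_of_le_of_ne h hne)
      exact absurd ((hS.sign_eq h1 h'.1).symm.trans (hS.sign_eq h2 h'.2)) (by simp)
    · intro h
      have h' := (hS.lt_iff hf hle).1 (lt_of_le_of_ne h hne.symm)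
      exact absurd ((hS.sign_eq h2 h'.1).symm.trans (hS.sign_eq h1 h'.2)) (by simp)

theorem pair_of_simU {a b : α} (h : SimU a b) : f b ∈ S true (f a) ∧ f a ∈ S true (f b) := by
  obtain ⟨hinc, c, hac, hbc⟩ := h
  obtain ⟨s, h1, h2⟩ := (hS.incompRel_iff hf hle).1 hinc
  cases s
  · obtain ⟨w, hw⟩ := hS.nonempty true (f c)
    exact absurd ((hle _ _).1 hac hw)
      (hS.disj (s := false) (hS.side_subset h1 h2 ((hle _ _).1 hbc hw)))
  · exact ⟨h1, h2⟩

theorem pair_of_simL {a b : α} (h : SimL a b) : f b ∈ S false (f a) ∧ f a ∈ S false (f b) := by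
  obtain ⟨hinc, c, hca, hcb⟩ := h
  obtain ⟨s, h1, h2⟩ := (hS.incompRel_iff hf hle).1 hinc
  cases s
  · exact ⟨h1, h2⟩
  -- The upper sides at `a` and `b` cover the whole space, whereas `c` is not above itself.
  · have hca' := (hle _ _).1 hca
    have hcb' := (hle _ _).1 hcb
    have hc : f c ∉ S true (f c) := hS.self_notMem _ _
    by_cases hac : f c = f a
    · exact absurd (hcb' (hac ▸ h2)) hc
    obtain ⟨t, ht⟩ := hS.cover hac
    cases t
    · exact absurd (hcb' (hS.side_subset h2 h1 ht)) hc
    · exact absurd (hca' ht) hc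

variable (hbd : ∀ s a b, f b ∈ S s (f a) → f a ∈ S s (f b) →
  ∃ c, f c ∈ S s (f a) ∧ f a ∈ S (!s) (f c) ∧ f c ∈ S s (f b) ∧ f b ∈ S (!s) (f c))

include hbd

/-- If pairs with equal signs have common bounds (on the side where this is possible), then `∼_u`
is the relation of lying on the upper sides of each other. -/
theorem simU_iff {a b : α} : SimU a b ↔ f b ∈ S true (f a) ∧ f a ∈ S true (f b) := by
  refine ⟨hS.pair_of_simU hf hle, fun h => ⟨(hS.incompRel_iff hf hle).2 ⟨_, h⟩, ?_⟩⟩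
  obtain ⟨c, h1, h2, h3, h4⟩ := hbd _ _ _ h.1 h.2
  exact ⟨c, ((hS.lt_iff hf hle).2 ⟨h1, h2⟩).le, ((hS.lt_iff hf hle).2 ⟨h3, h4⟩).le⟩

theorem simL_iff {a b : α} : SimL a b ↔ f b ∈ S false (f a) ∧ f a ∈ S false (f b) := by
  refine ⟨hS.pair_of_simL hf hle, fun h => ⟨(hS.incompRel_iff hf hle).2 ⟨_, h⟩, ?_⟩⟩
  obtain ⟨c, h1, h2, h3, h4⟩ := hbd _ _ _ h.1 h.2
  exact ⟨c, ((hS.lt_iff hf hle).2 ⟨h2, h1⟩).le, ((hS.lt_iff hf hle).2 ⟨h4, h3⟩).le⟩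

theorem simplyConnectedOrder : SimplyConnectedOrder α := by
  refine ⟨fun a b h => ?_, fun a b c hab hac => ?_⟩
  · obtain ⟨s, h⟩ := (hS.incompRel_iff hf hle).1 h
    cases s
    · exact Or.inr ((hS.simL_iff hf hle hbd).2 h)
    · exact Or.inl ((hS.simU_iff hf hle hbd).2 h)
  · obtain ⟨h1, h2⟩ := (hS.simU_iff hf hle hbd).1 hab
    obtain ⟨h3, h4⟩ := (hS.simL_iff hf hle hbd).1 hac
    exact (hS.lt_iff hf hle).2 ⟨hS.side_subset h2 h1 h3, hS.side_subset h4 h3 h1⟩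

/-- Betweenness in the order is separation in the space. -/
theorem orderBetween_iff {a b c : α} :
    OrderBetween a b c ↔ ∃ s, f a ∈ S s (f b) ∧ f c ∈ S (!s) (f b) := by
  simp only [OrderBetween, hS.simU_iff hf hle hbd, hS.simL_iff hf hle hbd, hS.lt_iff hf hle]
  constructor
  · rintro (⟨-, h | h⟩ | ⟨-, h | h⟩ | ⟨-, h | h⟩ | ⟨-, h | h⟩)
    · exact ⟨false, h.1.2, h.2.1⟩
    · exact ⟨true, h.1.2, h.2.1⟩
    · exact ⟨true, h.2.1, h.1.2⟩
    · exact ⟨false, h.2.1, h.1.2⟩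
    · exact ⟨false, h.1.2, h.2.1⟩
    · exact ⟨true, h.2.1, h.1.2⟩
    · exact ⟨true, h.1.2, h.2.2⟩
    · exact ⟨false, h.2.2, h.1.2⟩
  · rintro ⟨s, ha, hc⟩
    obtain ⟨p, hp⟩ := hS.cover (hS.ne_of_mem ha).symm
    obtain ⟨q, hq⟩ := hS.cover (hS.ne_of_mem hc).symm
    have hca : f c ∈ S p (f a) := hS.side_subset hp ha hc
    have hac : f a ∈ S q (f c) := hS.side_subset' hq hc ha
    cases s <;> cases p <;> cases q <;> simp_all

variable [LocallyPathConnectedSpace T] [PathConnectedSpace T]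

theorem betweenSet_eq (a b : α) : betweenSet a b = {c | f c ∈ geodesicSpine (f a) (f b)} := by
  ext c
  simp only [betweenSet, mem_union, mem_insert_iff, mem_singleton_iff, mem_ofPred_eq,
    hS.orderBetween_iff hf hle hbd, hS.mem_geodesicSpine_iff, hf.eq_iff, or_assoc]

omit hf hle hbd [PartialOrder α] in
theorem mem_spine_mid {a x y z : T} (hx : x ∈ geodesicSpine a y) (hy : y ∈ geodesicSpine a z) :
    y ∈ geodesicSpine x z := by
  rcases spine_subset_union a x z hy with h | h
  · rw [hS.spine_antisymm h hx]
    exact left_mem_spine _ _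
  · exact h

omit hf hle hbd [PartialOrder α] in
/-- Of three points of a spine, one is between the others. -/
theorem exists_middle {a b x y z : T} (hx : x ∈ geodesicSpine a b) (hy : y ∈ geodesicSpine a b)
    (hz : z ∈ geodesicSpine a b) :
    y ∈ geodesicSpine x z ∨ z ∈ geodesicSpine x y ∨ x ∈ geodesicSpine y z := by
  rcases hS.spine_total hx hy with h1 | h1 <;> rcases hS.spine_total hy hz with h2 | h2 <;>
    rcases hS.spine_total hx hz with h3 | h3
  · exact Or.inl (hS.mem_spine_mid h1 h2)
  · exact Or.inl (hS.mem_spine_mid h1 h2)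
  · exact Or.inr (Or.inl (hS.mem_spine_mid h3 h2))
  · exact Or.inr (Or.inr (by rw [spine_comm]; exact hS.mem_spine_mid h3 h1))
  · exact Or.inr (Or.inr (hS.mem_spine_mid h1 h3))
  · exact Or.inr (Or.inl (by rw [spine_comm]; exact hS.mem_spine_mid h2 h3))
  · exact Or.inl (by rw [spine_comm]; exact hS.mem_spine_mid h2 h1)
  · exact Or.inl (by rw [spine_comm]; exact hS.mem_spine_mid h2 h1)

/-- The relation "`B_{x,y}` is totally ordered" is transitive on each `B_{a,b}`. -/
theorem isChain_betweenSet_trans {a b x y z : α} (hx : x ∈ betweenSet a b)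
    (hy : y ∈ betweenSet a b) (hz : z ∈ betweenSet a b)
    (hxy : IsChain (· ≤ ·) (betweenSet x y)) (hyz : IsChain (· ≤ ·) (betweenSet y z)) :
    IsChain (· ≤ ·) (betweenSet x z) := by
  have hlt := @lt_iff _ _ _ hS _ _ _ hf hle
  simp only [hS.betweenSet_eq hf hle hbd] at *
  rcases hS.exists_middle hx hy hz with h | h | h
  · -- On both sides of `y` the order along the spine has the same direction, because `y`
    -- separates what precedes it from what follows it.
    have key : ∀ p q : α, f p ∈ geodesicSpine (f x) (f y) → f q ∈ geodesicSpine (f y) (f z) →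
        p ≤ q ∨ q ≤ p := by
      intro p q hp hq
      have h1 : f y ∈ geodesicSpine (f x) (f q) := by
        rw [spine_comm] at hq h ⊢
        exact hS.mem_spine_mid hq h
      have h2 : f y ∈ geodesicSpine (f p) (f q) := hS.mem_spine_mid hp h1
      have hpy : p ≤ y ∨ y ≤ p := hxy.total hp (right_mem_spine _ _)
      have hqy : q ≤ y ∨ y ≤ q := hyz.total hq (left_mem_spine _ _)
      rcases hS.mem_geodesicSpine_iff.1 h2 with e | e | ⟨s, hs, hs'⟩
      · obtain rfl := hf e
        exact hqy.symm
      · obtain rfl := hf e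
        exact hpy
      · have hpy' : p ≠ y := fun e => hS.ne_of_mem hs (congrArg f e)
        have hqy' : q ≠ y := fun e => hS.ne_of_mem hs' (congrArg f e)
        rcases hpy with hp | hp <;> rcases hqy with hq | hq
        · have e1 := hS.sign_eq hs (hlt.1 (lt_of_le_of_ne hp hpy')).2
          have e2 := hS.sign_eq hs' (hlt.1 (lt_of_le_of_ne hq hqy')).2
          simp_all
        · exact Or.inl (hp.trans hq)
        · exact Or.inr (hq.trans hp)
        · have e1 := hS.sign_eq hs (hlt.1 (lt_of_le_of_ne hp hpy'.symm)).1
          have e2 := hS.sign_eq hs' (hlt.1 (lt_of_le_of_ne hq hqy'.symm)).1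
          simp_all
    intro p hp q hq _
    rcases spine_subset_union _ (f y) _ hp with hp | hp <;>
      rcases spine_subset_union _ (f y) _ hq with hq | hq
    · exact hxy.total hp hq
    · exact key p q hp hq
    · exact (key q p hq hp).symm
    · exact hyz.total hp hq
  · exact hxy.mono fun c hc => hS.spine_subset_left h hc
  · refine hyz.mono fun c hc => hS.spine_subset h (right_mem_spine _ _) hc

theorem rectifiableOrder : RectifiableOrder α := by
  intro a b
  obtain ⟨γ⟩ := PathConnectedSpace.joined (f a) (f b)
  choose J _ hJo hzJ hJ hJc using fun z => hS.basis z univ univ_mem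
  obtain ⟨F, -, hF⟩ := (isCompact_range γ.continuous).elim_nhds_subcover J
    fun z _ => (hJo z).mem_nhds (hzJ z)
  have hcomm : ∀ x y : α, betweenSet x y = betweenSet y x := fun x y => by
    simp only [hS.betweenSet_eq hf hle hbd, spine_comm (f x)]
  -- Points of the spine in a common oriented interval belong to the same class.
  have hsub : ∀ z, (switchClass a b '' {c ∈ betweenSet a b | f c ∈ J z}).Subsingleton := by
    have key : ∀ z {c d : α}, c ∈ betweenSet a b → d ∈ betweenSet a b → f c ∈ J z → f d ∈ J z →
        switchClass a b c ⊆ switchClass a b d := by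
      rintro z c d hc hd hcJ hdJ e ⟨he, hce⟩
      refine ⟨he, hS.isChain_betweenSet_trans hf hle hbd hd hc he ?_ hce⟩
      rw [hS.betweenSet_eq hf hle hbd]
      have hsp := hS.spine_subset_of_isPreconnected (hJ z) hdJ hcJ
      intro p hp q hq hpq
      obtain ⟨s, h1, h2⟩ := hJc z _ (hsp hp) _ (hsp hq) (hf.ne hpq)
      cases s
      · exact Or.inr ((hS.lt_iff hf hle).2 ⟨h2, h1⟩).le
      · exact Or.inl ((hS.lt_iff hf hle).2 ⟨h1, h2⟩).le
    rintro z _ ⟨c, ⟨hc, hcJ⟩, rfl⟩ _ ⟨d, ⟨hd, hdJ⟩, rfl⟩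
    exact (key z hc hd hcJ hdJ).antisymm (key z hd hc hdJ hcJ)
  refine (F.finite_toSet.biUnion fun z _ => (hsub z).finite).subset ?_
  rintro _ ⟨c, hc, rfl⟩
  have hc' := hc
  rw [hS.betweenSet_eq hf hle hbd] at hc'
  obtain ⟨z, hz, hcz⟩ := mem_iUnion₂.1 (hF (mem_iInter.1 hc' γ))
  exact mem_iUnion₂.2 ⟨z, hz, c, ⟨hc, hcz⟩, rfl⟩

end SideSystem

/-! ### The sides of a point of an oriented simply connected 1-manifold -/

theorem StrictlyIncreasingNear.neg {f : ℝ → ℝ} {t : ℝ} (h : StrictlyIncreasingNear f t) :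
    StrictlyIncreasingNear (fun s => -f (-s)) (-t) := by
  obtain ⟨U, hU, hf⟩ := h
  refine ⟨Neg.neg ⁻¹' U, continuous_neg.continuousAt.preimage_mem_nhds (by simpa using hU), ?_⟩
  intro a ha b hb hab
  exact neg_lt_neg (hf hb ha (neg_lt_neg hab))

namespace OrientedOneManifold

variable {T : Type*} [TopologicalSpace T] (A : OrientedOneManifold T)

/-- The 1-manifold with the opposite orientation: all charts are composed with `t ↦ -t`. -/
def reverse : OrientedOneManifold T where
  charts := (fun e => e.transHomeomorph (Homeomorph.neg ℝ)) '' A.charts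
  covers x := by
    obtain ⟨e, he, hx⟩ := A.covers x
    exact ⟨_, mem_image_of_mem _ he, hx⟩
  compatible := by
    rintro _ ⟨e, he, rfl⟩ _ ⟨e', he', rfl⟩ x hx
    exact (A.compatible e he e' he' x hx).neg

theorem PreservesOrientation.reverse {f : T → T} (h : A.PreservesOrientation f) :
    A.reverse.PreservesOrientation f := by
  rintro _ ⟨e, he, rfl⟩ _ ⟨e', he', rfl⟩ x hx hfx
  exact (h e he e' he' x hx hfx).neg

/-- The charts of `A` as an atlas in the sense of Mathlib. -/
noncomputable abbrev toChartedSpace : ChartedSpace ℝ T where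
  atlas := A.charts
  chartAt x := (A.covers x).choose
  mem_chart_source x := (A.covers x).choose_spec.2
  chart_mem_atlas x := (A.covers x).choose_spec.1

theorem exists_interval {z : T} {U : Set T} (hU : U ∈ 𝓝 z) :
    ∃ e ∈ A.charts, z ∈ e.source ∧ ∃ δ > 0, Ioo (e z - δ) (e z + δ) ⊆ e.target ∧
      e.symm '' Ioo (e z - δ) (e z + δ) ⊆ U := by
  obtain ⟨e, he, hz⟩ := A.covers z
  have h1 : ∀ᶠ r in 𝓝 (e z), r ∈ e.target ∧ e.symm r ∈ U :=
    Filter.Eventually.and (e.open_target.mem_nhds (e.map_source hz))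
      ((e.tendsto_symm hz).eventually hU)
  obtain ⟨δ, hδ, hball⟩ := Metric.eventually_nhds_iff_ball.1 h1
  rw [Real.ball_eq_Ioo] at hball
  refine ⟨e, he, hz, δ, hδ, fun r hr => (hball r hr).1, ?_⟩
  rintro _ ⟨r, hr, rfl⟩
  exact (hball r hr).2

/-- A continuous map that increases in charts takes points just above `x` to points just
above its image. -/
theorem exists_just_above {f : T → T} (hf : Continuous f) {e e' : OpenPartialHomeomorph T ℝ}
    {x : T} (hx : x ∈ e.source) (hfx : f x ∈ e'.source)
    (hinc : StrictlyIncreasingNear (fun s => e' (f (e.symm s))) (e x)) {t t' : ℝ}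
    (ht : e x < t) (ht' : e' (f x) < t') :
    ∃ r ∈ Ioo (e x) t, f (e.symm r) ∈ e'.source ∧ e' (f (e.symm r)) ∈ Ioo (e' (f x)) t' := by
  obtain ⟨U, hU, hmono⟩ := hinc
  have hlim : Tendsto (fun r => f (e.symm r)) (𝓝 (e x)) (𝓝 (f x)) :=
    (hf.tendsto x).comp (e.tendsto_symm hx)
  have h1 : ∀ᶠ r in 𝓝 (e x), r ∈ U ∧ f (e.symm r) ∈ e'.source ∧ e' (f (e.symm r)) < t' :=
    Filter.Eventually.and hU ((hlim.eventually (e'.open_source.mem_nhds hfx)).and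
      (((e'.continuousAt hfx).tendsto.comp hlim).eventually (gt_mem_nhds ht')))
  obtain ⟨r, hr, hrt⟩ := ((h1.filter_mono nhdsWithin_le_nhds).and
    (Ioo_mem_nhdsGT ht)).exists
  have hlt := hmono (mem_of_mem_nhds hU) hr.1 hrt.1
  simp only [e.left_inv hx] at hlt
  exact ⟨r, hrt, hr.2.1, hlt, hr.2.2⟩

theorem symm_ne {e : OpenPartialHomeomorph T ℝ} {x : T} {r : ℝ} (hr : r ∈ e.target)
    (hne : r ≠ e x) : e.symm r ≠ x := by
  rintro rfl
  exact hne (e.right_inv hr).symm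

theorem connectedComponentIn_symm {e : OpenPartialHomeomorph T ℝ} {x : T} {t r : ℝ}
    (ht : Icc (e x) t ⊆ e.target) (hr : r ∈ Ioc (e x) t) :
    connectedComponentIn {x}ᶜ (e.symm r) = connectedComponentIn {x}ᶜ (e.symm t) := by
  have hsub : Icc r t ⊆ e.target := (Icc_subset_Icc_left hr.1.le).trans ht
  have hpre : IsPreconnected (e.symm '' Icc r t) :=
    isPreconnected_Icc.image _ (e.continuousOn_symm.mono hsub)
  refine (connectedComponentIn_eq (hpre.subset_connectedComponentIn
    (mem_image_of_mem _ (right_mem_Icc.2 hr.2)) ?_ (mem_image_of_mem _ (left_mem_Icc.2 hr.2)))).symm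
  rintro _ ⟨q, hq, rfl⟩
  exact symm_ne (hsub hq) (hr.1.trans_le hq.1).ne'

/-- The positive side of a point can be computed in any chart. -/
theorem posSide_eq {e : OpenPartialHomeomorph T ℝ} (he : e ∈ A.charts) {x : T} {t : ℝ}
    (hx : x ∈ e.source) (ht : e x < t) (hsub : Icc (e x) t ⊆ e.target) :
    A.posSide x = connectedComponentIn {x}ᶜ (e.symm t) := by
  ext y
  refine ⟨?_, fun hy => ⟨e, he, t, hx, ht, hsub, hy⟩⟩
  rintro ⟨e', he', t', hx', ht', hsub', hy⟩
  obtain ⟨r, hr, hrs, hr'⟩ := exists_just_above continuous_id hx hx'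
    (A.compatible e he e' he' x ⟨hx, hx'⟩) ht ht'
  rw [← connectedComponentIn_symm hsub (Ioo_subset_Ioc_self hr)]
  rw [← connectedComponentIn_symm hsub' (Ioo_subset_Ioc_self hr')] at hy
  have hrs' : e'.symm (e' (e.symm r)) = e.symm r := e'.left_inv hrs
  rw [← hrs']
  exact hy

theorem symm_mem_posSide {e : OpenPartialHomeomorph T ℝ} (he : e ∈ A.charts) {r t : ℝ}
    (h : r < t) (hsub : Icc r t ⊆ e.target) : e.symm t ∈ A.posSide (e.symm r) := by
  have hr : r ∈ e.target := hsub (left_mem_Icc.2 h.le)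
  have ht : t ∈ e.target := hsub (right_mem_Icc.2 h.le)
  have hx : e (e.symm r) = r := e.right_inv hr
  refine ⟨e, he, t, e.map_target hr, by rwa [hx], by rwa [hx], ?_⟩
  exact mem_connectedComponentIn (symm_ne ht (by rw [hx]; exact h.ne'))

theorem symm_mem_reverse_posSide {e : OpenPartialHomeomorph T ℝ} (he : e ∈ A.charts) {r t : ℝ}
    (h : r < t) (hsub : Icc r t ⊆ e.target) :
    e.symm r ∈ A.reverse.posSide (e.symm t) := by
  have := A.reverse.symm_mem_posSide (mem_image_of_mem _ he) (neg_lt_neg h) (by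
    intro q hq
    exact hsub (show -q ∈ Icc r t from ⟨by linarith [hq.2], by linarith [hq.1]⟩))
  simpa using this

theorem exists_posSide_eq (x : T) :
    ∃ y ≠ x, A.posSide x = connectedComponentIn {x}ᶜ y := by
  obtain ⟨e, he, hx, δ, hδ, hsub, -⟩ := A.exists_interval (univ_mem : univ ∈ 𝓝 x)
  have hI : Icc (e x) (e x + δ / 2) ⊆ e.target := fun r hr =>
    hsub ⟨by linarith [hr.1], by linarith [hr.2]⟩
  exact ⟨_, symm_ne (hI (right_mem_Icc.2 (by linarith))) (by linarith),
    A.posSide_eq he hx (by linarith) hI⟩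

theorem isPreconnected_posSide (x : T) : IsPreconnected (A.posSide x) := by
  obtain ⟨y, -, h⟩ := A.exists_posSide_eq x
  exact h ▸ isPreconnected_connectedComponentIn

theorem self_notMem_posSide (x : T) : x ∉ A.posSide x := by
  rintro ⟨e, he, t, hx, ht, hsub, hy⟩
  exact connectedComponentIn_subset _ _ hy rfl

/-- The positive side of `x` is a component of the complement of `x`. -/
theorem posSide_eq_of_mem {x y : T} (hy : y ∈ A.posSide x) :
    A.posSide x = connectedComponentIn {x}ᶜ y := by
  obtain ⟨z, -, h⟩ := A.exists_posSide_eq x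
  rw [h] at hy ⊢
  exact connectedComponentIn_eq hy

theorem isOpen_posSide [LocallyPathConnectedSpace T] [T1Space T] (x : T) :
    IsOpen (A.posSide x) := by
  obtain ⟨y, -, h⟩ := A.exists_posSide_eq x
  exact h ▸ isOpen_compl_singleton.connectedComponentIn

theorem mem_closure_posSide (x : T) : x ∈ closure (A.posSide x) := by
  refine mem_closure_iff_nhds.2 fun U hU => ?_
  obtain ⟨e, he, hx, δ, hδ, hsub, hJ⟩ := A.exists_interval hU
  refine ⟨e.symm (e x + δ / 2), hJ (mem_image_of_mem _ ⟨by linarith, by linarith⟩), ?_⟩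
  have := A.symm_mem_posSide he (r := e x) (t := e x + δ / 2) (by linarith)
    fun r hr => hsub ⟨by linarith [hr.1], by linarith [hr.2]⟩
  rwa [e.left_inv hx] at this

/-- An orientation-preserving group action maps positive sides to positive sides. -/
theorem smul_mem_posSide {G : Type*} [Group G] [MulAction G T] [ContinuousConstSMul G T] {g : G}
    (hg : A.PreservesOrientation (fun x : T => g • x)) {x y : T} (hy : y ∈ A.posSide x) :
    g • y ∈ A.posSide (g • x) := by
  obtain ⟨e, he, t, hx, ht, hsub, hy⟩ := hy
  obtain ⟨e', he', hx', δ, hδ, hsub', -⟩ := A.exists_interval (univ_mem : univ ∈ 𝓝 (g • x))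
  obtain ⟨r, hr, hrs, hr'⟩ := exists_just_above (continuous_const_smul g) hx hx'
    (hg e he e' he' x hx hx') ht (show e' (g • x) < e' (g • x) + δ by linarith)
  rw [← connectedComponentIn_symm hsub (Ioo_subset_Ioc_self hr)] at hy
  refine ⟨e', he', e' (g • e.symm r), hx', hr'.1, fun q hq => hsub' ⟨by linarith [hq.1],
    hq.2.trans_lt hr'.2⟩, ?_⟩
  rw [e'.left_inv hrs]
  have hpre := (isPreconnected_connectedComponentIn (F := ({x}ᶜ : Set T))
    (x := e.symm r)).image _ (continuous_const_smul g).continuousOn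
  refine hpre.subset_connectedComponentIn (mem_image_of_mem _ (mem_connectedComponentIn
    (symm_ne (hsub (Ioo_subset_Icc_self hr)) hr.1.ne'))) ?_ (mem_image_of_mem _ hy)
  rintro _ ⟨w, hw, rfl⟩ h
  exact connectedComponentIn_subset _ _ hw (MulAction.injective g h)

/-- The sides of the points of an oriented 1-manifold: the positive one, and the positive one
for the opposite orientation. -/
def side (s : Bool) (x : T) : Set T := if s then A.posSide x else A.reverse.posSide x

/-- In a simply connected oriented 1-manifold the complement of a point is the disjoint union of
its two sides. They are disjoint by `not_mem_preconnected_of_locally_separated`; they cover,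
because every component of the complement accumulates at the point. -/
theorem sideSystem [SimplyConnectedSpace T] : SideSystem A.side := by
  let _ : ChartedSpace ℝ T := A.toChartedSpace
  have : LocallyPathConnectedSpace T := ChartedSpace.locallyPathConnectedSpace ℝ T
  have : T1Space T := ChartedSpace.t1Space ℝ T
  refine ⟨?_, ?_, ?_, ?_, ?_, ?_, ?_⟩
  · rintro (_ | _) x
    exacts [A.reverse.isOpen_posSide x, A.isOpen_posSide x]
  · rintro (_ | _) x
    exacts [A.reverse.isPreconnected_posSide x, A.isPreconnected_posSide x]
  · rintro (_ | _) x
    exacts [A.reverse.self_notMem_posSide x, A.self_notMem_posSide x]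
  · have key : ∀ {x y : T}, y ∈ A.posSide x → y ∉ A.reverse.posSide x := by
      intro x y hy hy'
      obtain ⟨e, he, hx, δ, hδ, hsub, -⟩ := A.exists_interval (univ_mem : univ ∈ 𝓝 x)
      have heq : A.reverse.posSide x = A.posSide x := by
        rw [A.posSide_eq_of_mem hy, A.reverse.posSide_eq_of_mem hy']
      have hpos : ∀ {r}, r ∈ Ioo (e x) (e x + δ) → e.symm r ∈ A.posSide x := by
        intro r hr
        have := A.symm_mem_posSide he hr.1
          fun q hq => hsub ⟨by linarith [hq.1], by linarith [hq.2, hr.2]⟩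
        rwa [e.left_inv hx] at this
      have hneg : ∀ {r}, r ∈ Ioo (e x - δ) (e x) → e.symm r ∈ A.posSide x := by
        intro r hr
        have := A.symm_mem_reverse_posSide he hr.2
          fun q hq => hsub ⟨by linarith [hq.1, hr.1], by linarith [hq.2]⟩
        rwa [e.left_inv hx, heq] at this
      have hsubM : Ioo (e x - δ) (e x) ⊆ e.target := fun r hr =>
        hsub ⟨hr.1, by linarith [hr.2]⟩
      have hsubK : Ioo (e x) (e x + δ) ⊆ e.target := fun r hr =>
        hsub ⟨by linarith [hr.1], hr.2⟩
      have hmid : e x - δ / 2 ∈ Ioo (e x - δ) (e x) := ⟨by linarith, by linarith⟩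
      have hmid' : e x + δ / 2 ∈ Ioo (e x) (e x + δ) := ⟨by linarith, by linarith⟩
      refine not_mem_preconnected_of_locally_separated (x := x)
        (V := e.symm '' Ioo (e x - δ) (e x + δ))
        (M := e.symm '' Ioo (e x - δ) (e x)) (K := e.symm '' Ioo (e x) (e x + δ))
        isClosed_singleton (e.isOpen_image_symm_of_subset_target isOpen_Ioo hsub)
        (isPreconnected_Ioo.image _ (e.continuousOn_symm.mono hsub))
        ⟨e x, ⟨by linarith, by linarith⟩, e.left_inv hx⟩
        (e.isOpen_image_symm_of_subset_target isOpen_Ioo hsubM)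
        (e.isOpen_image_symm_of_subset_target isOpen_Ioo hsubK) ?_ ?_
        (A.isPreconnected_posSide x) (A.self_notMem_posSide x)
        (mem_image_of_mem _ hmid) (mem_image_of_mem _ ⟨by linarith, by linarith⟩) (hneg hmid)
        (mem_image_of_mem _ hmid') (mem_image_of_mem _ ⟨by linarith, by linarith⟩) (hpos hmid')
      · rw [Set.disjoint_left]
        rintro _ ⟨r, hr, rfl⟩ ⟨q, hq, hqr⟩
        have := e.symm.injOn (hsubK hq) (hsubM hr) hqr
        linarith [hr.2, hq.1]
      · rintro _ ⟨⟨r, hr, rfl⟩, hne⟩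
        rcases lt_trichotomy r (e x) with h | h | h
        · exact Or.inl ⟨r, ⟨hr.1, h⟩, rfl⟩
        · exact absurd (by rw [h]; exact e.left_inv hx) hne
        · exact Or.inr ⟨r, ⟨h, hr.2⟩, rfl⟩
    rintro (_ | _) x y hy
    · exact fun h => key h hy
    · exact key hy
  · intro x y hyx
    set C := connectedComponentIn {x}ᶜ y with hC
    have hCo : IsOpen C := isOpen_compl_singleton.connectedComponentIn
    have hyC : y ∈ C := mem_connectedComponentIn hyx
    have hxC : x ∈ closure C := by
      by_contra hx
      have hsub : closure C ⊆ C :=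
        isPreconnected_connectedComponentIn.closure.subset_connectedComponentIn
          (subset_closure hyC) fun z hz h => hx (h ▸ hz)
      have huniv : C = univ := IsClopen.eq_univ ⟨closure_subset_iff_isClosed.1 hsub, hCo⟩ ⟨y, hyC⟩
      exact connectedComponentIn_subset ({x}ᶜ : Set T) y (huniv ▸ mem_univ x : x ∈ C) rfl
    obtain ⟨e, he, hx, δ, hδ, hsub, -⟩ := A.exists_interval (univ_mem : univ ∈ 𝓝 x)
    obtain ⟨_, ⟨r, hr, rfl⟩, hrC⟩ := mem_closure_iff.1 hxC _
      (e.isOpen_image_symm_of_subset_target isOpen_Ioo hsub)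
      ⟨e x, ⟨by linarith, by linarith⟩, e.left_inv hx⟩
    rcases lt_trichotomy r (e x) with h | h | h
    · have := A.symm_mem_reverse_posSide he h
        fun q hq => hsub ⟨by linarith [hq.1, hr.1], by linarith [hq.2]⟩
      rw [e.left_inv hx] at this
      refine ⟨false, ?_⟩
      change y ∈ A.reverse.posSide x
      rwa [A.reverse.posSide_eq_of_mem this, ← connectedComponentIn_eq hrC]
    · subst h
      rw [e.left_inv hx] at hrC
      exact absurd rfl (connectedComponentIn_subset ({x}ᶜ : Set T) y hrC)
    · have := A.symm_mem_posSide he h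
        fun q hq => hsub ⟨by linarith [hq.1], by linarith [hq.2, hr.2]⟩
      rw [e.left_inv hx] at this
      refine ⟨true, ?_⟩
      change y ∈ A.posSide x
      rwa [A.posSide_eq_of_mem this, ← connectedComponentIn_eq hrC]
  · rintro (_ | _) x
    exacts [A.reverse.mem_closure_posSide x, A.mem_closure_posSide x]
  · intro z U hU
    obtain ⟨e, he, hz, δ, hδ, hsub, hJ⟩ := A.exists_interval hU
    refine ⟨_, hJ, e.isOpen_image_symm_of_subset_target isOpen_Ioo hsub,
      ⟨e z, ⟨by linarith, by linarith⟩, e.left_inv hz⟩,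
      isPreconnected_Ioo.image _ (e.continuousOn_symm.mono hsub), ?_⟩
    rintro _ ⟨a, ha, rfl⟩ _ ⟨b, hb, rfl⟩ hab
    have hI : ∀ {a b}, a ∈ Ioo (e z - δ) (e z + δ) → b ∈ Ioo (e z - δ) (e z + δ) →
        Icc a b ⊆ e.target := fun ha hb q hq =>
      hsub ⟨ha.1.trans_le hq.1, hq.2.trans_lt hb.2⟩
    rcases lt_trichotomy a b with h | rfl | h
    · exact ⟨true, A.symm_mem_posSide he h (hI ha hb),
        A.symm_mem_reverse_posSide he h (hI ha hb)⟩
    · exact absurd rfl hab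
    · exact ⟨false, A.symm_mem_reverse_posSide he h (hI hb ha),
        A.symm_mem_posSide he h (hI hb ha)⟩

end OrientedOneManifold

/-! ### The order on the group -/

theorem theorem5p1 {G : Type*} [Group G] [Countable G]
    {T : Type*} [TopologicalSpace T] [SimplyConnectedSpace T]
    (A : OrientedOneManifold T)
    [MulAction G T] [ContinuousConstSMul G T]
    (horient : ∀ g : G, A.PreservesOrientation (fun x : T => g • x))
    (hminimal : IsMinimalTreeAction T G)
    (hends : ¬ ∃! ε : Set (Set T), IsEnd ε ∧ FixesEnd G ε)
    (x : T) (hstab : MulAction.stabilizer G x = ⊥) :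
    ∃ _ : PartialOrder G,
      (∀ g h : G, g ≤ h ↔ A.pointLE (g • x) (h • x)) ∧
      (∀ f g h : G, g ≤ h → f * g ≤ f * h) ∧
      SimplyConnectedOrder G ∧
      RectifiableOrder G ∧
      ¬ TrivialOrder G := by
  let _ : ChartedSpace ℝ T := A.toChartedSpace
  have : LocallyPathConnectedSpace T := ChartedSpace.locallyPathConnectedSpace ℝ T
  have hS : SideSystem A.side := A.sideSystem
  have he : SideSystem.Equivariant A.side G := by
    rintro g (_ | _) p q hq
    · exact A.reverse.smul_mem_posSide (horient g).reverse hq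
    · exact A.smul_mem_posSide (horient g) hq
  have hinj : Function.Injective fun g : G => g • x := by
    intro g h hgh
    have hmem : h⁻¹ * g ∈ MulAction.stabilizer G x := by
      rw [MulAction.mem_stabilizer_iff, mul_smul, inv_smul_eq_iff]
      exact hgh
    rw [hstab, Subgroup.mem_bot, inv_mul_eq_one] at hmem
    exact hmem.symm
  let P : PartialOrder G :=
    { le := fun g h => A.pointLE (g • x) (h • x)
      le_refl := fun g => subset_rfl
      le_trans := fun g h k hgh hhk => hhk.trans hgh
      le_antisymm := by
        intro g h hgh hhg
        by_contra hne
        have h1 := (hS.side_subset_side_iff (s := true) (hinj.ne hne)).1 hgh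
        exact hS.self_notMem true _ (hhg h1.1) }
  have hle : ∀ g h : G, g ≤ h ↔ A.side true (h • x) ⊆ A.side true (g • x) := fun g h => Iff.rfl
  -- If all incomparable pairs had the same sign, exactly one end would be fixed.
  have hpair : ∀ s, (∃ g h : G, h • x ∈ A.side s (g • x) ∧ g • x ∈ A.side s (h • x)) →
      ∃ g h : G, h • x ∈ A.side (!s) (g • x) ∧ g • x ∈ A.side (!s) (h • x) := by
    intro s hs
    by_contra! hno
    exact hends (hS.existsUnique_fixed_end he hno hminimal hs)
  have hpair' : ∀ s, (∃ g h : G, h • x ∈ A.side s (g • x) ∧ g • x ∈ A.side s (h • x)) →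
      ∀ t, ∃ g h : G, h • x ∈ A.side t (g • x) ∧ g • x ∈ A.side t (h • x) := by
    intro s hs t
    by_cases hts : t = s
    · exact hts ▸ hs
    · obtain rfl : t = !s := by cases s <;> cases t <;> simp_all
      exact hpair s hs
  have hbd : ∀ s (g h : G), h • x ∈ A.side s (g • x) → g • x ∈ A.side s (h • x) →
      ∃ k : G, k • x ∈ A.side s (g • x) ∧ g • x ∈ A.side (!s) (k • x) ∧
        k • x ∈ A.side s (h • x) ∧ h • x ∈ A.side (!s) (k • x) := fun s g h h1 h2 =>
    hS.exists_smul_common_bound he hminimal (hpair' s ⟨g, h, h1, h2⟩) h1 h2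
  refine ⟨P, fun g h => Iff.rfl, fun f g h hgh => ?_, hS.simplyConnectedOrder hinj hle hbd,
    hS.rectifiableOrder hinj hle hbd, ?_⟩
  · rintro z hz
    have hz' : f⁻¹ • z ∈ A.side true (h • x) := by
      simpa [mul_smul] using he f⁻¹ true _ _ hz
    have := he f true _ _ (hle g h |>.1 hgh hz')
    rwa [smul_inv_smul, ← mul_smul] at this
  · rintro ⟨⟨g, h, hgh⟩, htriv⟩
    obtain ⟨s, hs⟩ := (hS.incompRel_iff hinj hle).1 hgh
    have hboth := hpair' s ⟨g, h, hs⟩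
    rcases htriv with hU | hL
    · obtain ⟨a, b, hab⟩ := hboth false
      have := hS.pair_of_simU hinj hle (hU a b ((hS.incompRel_iff hinj hle).2 ⟨_, hab⟩))
      exact hS.disj hab.1 this.1
    · obtain ⟨a, b, hab⟩ := hboth true
      have := hS.pair_of_simL hinj hle (hL a b ((hS.incompRel_iff hinj hle).2 ⟨_, hab⟩))
      exact hS.disj hab.1 this.1
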